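/- **Flow polytopes.** Consider a graph on the vertices $s<1<\dots<n<t$ in which each edge joins two vertices $i<j$ and is either a forward edge $(i,j,+)$, directed to $j$, a backward edge $(i,j,-)$, directed to $i$, or a bidirectional edge $(i,j,\pm)$. Edges with different signs are different. The flow polytope $\mathcal F_G\subset\mathbb R^{E(G)}$ is the set of all $x=(x_e)_{e\in E(G)}$ such that, for each vertex $j$, $\sum_{e=(j,k),\,j<k}x_e-\sum_{e=(i,j),\,i<j}x_e$ equals $1$ if $j=s$, $-1$ if $j=t$ and $0$ otherwise, with $x_e\ge 0$ for forward edges, $x_e\le 0$ for backward edges and $x_e\in\mathbb R$ for bidirectional edges. A route is a directed path (without repeated vertices) from $s$ to $t$. Its signed characteristic vector in $\mathbb R^{E(G)}$ has entry $1$ at edges $(i,j)$, $i<j$, traversed from $i$ to $j$, entry $-1$ at edges traversed from $j$ to $i$ (traversed backward), and $0$ elsewhere. Lattice polytopes $P\subset\mathbb R^k$, $Q\subset\mathbb R^\ell$ are integrally equivalent, $P\equiv Q$, if some affine map $\varphi:\mathbb R^k\to\mathbb R^\ell$ restricts to a bijection $P\to Q$ and to a bijection $\mathbb Z^k\cap\operatorname{aff}(P)\to\mathbb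 Z^\ell\cap\operatorname{aff}(Q)$. For graphs on the same vertices, the intersection consists of the common edges. **Graphs of a lattice path.** Let $\nu$ be a lattice path from $(0,0)$ to $(a,b)$, $a,b\ge 0$, with steps $E=(1,0)$ and $N=(0,1)$. Let $\overline\nu=E\nu N$ and let $w$ be the number of its valleys (consecutive pairs $EN$). Index the letters of $\overline\nu$ from left to right by the positive integers $1,2,\dots,n$, each letter receiving the next integer, except that the first $N$ of each run of $N$'s receives the index of the preceding $E$. Let $I$ and $J$ be the sets of indices of the $E$'s and of the $N$'s. Then $I\cap J=\{v_1<\dots<v_w\}$ is the set of indices of the valleys. - $G(\nu)$ is the graph whose edges are the forward edges $(i,j,+)$, $1\le i<j\le n$, such that $\overline\nu$ has a subword $E_i\cdots N_j$ of consecutive letters all of whose valleys have index $i$ or $j$. - $G_B(\nu)$ is obtained from $G(\nu)$ by making the edges between elements of $I\cap J$ bidirectional. These form the path $v_1,v_2,\dots,v_w$. - For $i\in[w]$, $G(\nu,i)$ is obtained from $G_B(\nu)$ by replacing the bidirectional edges by the edges of the cycle $(v_1,v_2,+),\dots,(v_{w-1},v_w,+),(v_1,v_w,-)$ other than the one that begins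 at $v_i$ (the last one begins at $v_w$; for $w=1$ no edge is left). - For each of these graphs $G$, the partial augmentation $\widetilde G$ is obtained by adding the forward edges $(s,i)$ for $i\in I$ and $(j,t)$ for $j\in J$. **The polytopes $\mathcal Q_i\subset\mathbb R^{E(\widetilde G_B(\nu))}$.** For $1\le i<w$, $\mathcal Q_i$ is the convex hull of the signed characteristic vectors of the routes of $\widetilde G_B(\nu)$ that do not traverse $(v_i,v_{i+1},\pm)$ from $v_i$ to $v_{i+1}$ and that, if they traverse any edge backward, traverse $(v_i,v_{i+1},\pm)$ backward. Let $\mathcal Q_w=\mathcal F_{\widetilde G(\nu)}$, where the coordinates of edges with the same endpoints are identified. **Theorem 1.1.** For every lattice path $\nu$ as above, $$\mathcal F_{\widetilde G_B(\nu)}=\bigcup_{i=1}^w\mathcal Q_i,$$ where $\mathcal Q_1,\dots,\mathcal Q_w$ are lattice polytopes with pairwise disjoint relative interiors. Furthermore, for every nonempty $S\subseteq[w]$, $$\bigcap_{i\in S}\mathcal Q_i\equiv\mathcal F_{\bigcap_{i\in S}\widetilde G(\nu,i)}.$$ -/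

import Mathlib

namespace SimplexSubdivision

/-! ### Mixed graphs, flows and routes -/

/-- The three types of edges: directed to the larger endpoint, directed to the smaller
endpoint, or bidirectional. -/
inductive EdgeKind
  | forward
  | backward
  | bidirectional
  deriving DecidableEq

/-- An edge `(lo, hi, kind)`; the vertices are natural numbers and `lo < hi` for all edges of
the graphs below. Two edges are equal only if their kinds agree as well. -/
structure Edge where
  lo : ℕ
  hi : ℕ
  kind : EdgeKind
  deriving DecidableEq

/-- A graph on the vertices `0, 1, …, n, n + 1`. The vertices `1, …, n` are the inner ones;
`0` plays the role of the source `s` and `n + 1` that of the sink `t` (they are isolated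
before the graph is augmented). -/
structure MixedGraph (n : ℕ) where
  edges : Finset Edge

/-- The netflow of `x` at `j`: the flow on the edges `(j, k)` with `j < k` minus the flow on the
edges `(i, j)` with `i < j`. -/
def MixedGraph.netflow {n : ℕ} (G : MixedGraph n) (x : G.edges → ℝ) (j : ℕ) : ℝ :=
  (∑ e : G.edges, if e.1.lo = j then x e else 0) - ∑ e : G.edges, if e.1.hi = j then x e else 0

/-- The flow polytope of `G`, in the real vector space with one coordinate for each edge:
netflow `1` at the source, `-1` at the sink and `0` at the inner vertices, with nonnegative flow
on forward edges, nonpositive flow on backward edges and any real flow on bidirectional edges. -/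
def MixedGraph.flowPolytope {n : ℕ} (G : MixedGraph n) : Set (G.edges → ℝ) :=
  {x | (∀ j ≤ n + 1, G.netflow x j = (if j = 0 then 1 else 0) - (if j = n + 1 then 1 else 0)) ∧
    (∀ e : G.edges, e.1.kind = EdgeKind.forward → 0 ≤ x e) ∧
    (∀ e : G.edges, e.1.kind = EdgeKind.backward → x e ≤ 0)}

/-- An edge together with a direction in which it is traversed: `up = true` means from the
smaller endpoint to the larger one. -/
structure Arc where
  edge : Edge
  up : Bool
  deriving DecidableEq

/-- The vertex at which the arc starts. -/
def Arc.tail (c : Arc) : ℕ := if c.up then c.edge.lo else c.edge.hi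

/-- The vertex at which the arc ends. -/
def Arc.head (c : Arc) : ℕ := if c.up then c.edge.hi else c.edge.lo

/-- The direction of the arc is one that its edge permits. -/
def Arc.Permitted (c : Arc) : Prop :=
  if c.up then c.edge.kind ≠ EdgeKind.backward else c.edge.kind ≠ EdgeKind.forward

/-- Directed walks of `G`, as lists of arcs. -/
inductive MixedGraph.IsWalk {n : ℕ} (G : MixedGraph n) : ℕ → List Arc → ℕ → Prop
  | nil (u : ℕ) : MixedGraph.IsWalk G u [] u
  | cons (c : Arc) (R : List Arc) (u : ℕ) (hmem : c.edge ∈ G.edges) (hdir : c.Permitted)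
      (hwalk : MixedGraph.IsWalk G c.head R u) : MixedGraph.IsWalk G c.tail (c :: R) u

/-- A route: a directed path (no vertex is repeated) from the source to the sink. -/
def MixedGraph.IsRoute {n : ℕ} (G : MixedGraph n) (R : List Arc) : Prop :=
  G.IsWalk 0 R (n + 1) ∧ (0 :: R.map Arc.head).Nodup

/-- The signed characteristic vector of a route: `1` on edges traversed from the smaller to the
larger endpoint, `-1` on edges traversed the other way, `0` on all other edges. -/
def MixedGraph.charVector {n : ℕ} (G : MixedGraph n) (R : List Arc) : G.edges → ℝ :=
  fun e => if Arc.mk e.1 true ∈ R then 1 else if Arc.mk e.1 false ∈ R then -1 else 0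

/-- The intersection of a nonempty family of graphs on the same vertex set: its edges are the
common edges. -/
def MixedGraph.inter {n : ℕ} {ι : Type} (G : ι → MixedGraph n) (S : Finset ι)
    (hS : S.Nonempty) : MixedGraph n where
  edges := S.inf' hS fun i => (G i).edges

/-! ### Lattice polytopes and integral equivalence -/

/-- The integer points of `ℝ^ι`. -/
def integerPoints (ι : Type) : Set (ι → ℝ) := {x | ∀ i, ∃ m : ℤ, x i = m}

/-- A lattice polytope: the convex hull of finitely many integer points. -/
def IsLatticePolytope {ι : Type} (P : Set (ι → ℝ)) : Prop :=
  ∃ F : Finset (ι → ℝ), (F : Set (ι → ℝ)) ⊆ integerPoints ι ∧ P = convexHull ℝ (F : Set (ι → ℝ))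

/-- Integral equivalence of lattice polytopes: some affine map restricts to a bijection between
the two polytopes, and to a bijection between the integer points of their affine hulls. -/
def IntegrallyEquivalent {ι κ : Type} (P : Set (ι → ℝ)) (Q : Set (κ → ℝ)) : Prop :=
  IsLatticePolytope P ∧ IsLatticePolytope Q ∧
    ∃ φ : (ι → ℝ) →ᵃ[ℝ] (κ → ℝ), Set.BijOn φ P Q ∧
      Set.BijOn φ (integerPoints ι ∩ (affineSpan ℝ P : Set (ι → ℝ)))
        (integerPoints κ ∩ (affineSpan ℝ Q : Set (κ → ℝ)))

/-! ### Lattice paths, valleys and the canonical indexing -/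

/-- The steps `E = (1, 0)` and `N = (0, 1)`. A lattice path `ν` starting at the origin is the list
of its steps; it ends at the point (number of `E`s, number of `N`s). -/
inductive Step
  | E
  | N
  deriving DecidableEq

/-- The path `E ν N`. Its letters are at the positions `0, 1, …, ν.length + 1`. -/
def bar (ν : List Step) : List Step := Step.E :: ν ++ [Step.N]

/-- The letter of `E ν N` at position `p` is an `E`. -/
def IsE (ν : List Step) (p : ℕ) : Prop := (bar ν)[p]? = some Step.E

/-- The letter of `E ν N` at position `p` is an `N`. -/
def IsN (ν : List Step) (p : ℕ) : Prop := (bar ν)[p]? = some Step.N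

instance (ν : List Step) (p : ℕ) : Decidable (IsE ν p) :=
  inferInstanceAs (Decidable ((bar ν)[p]? = some Step.E))

instance (ν : List Step) (p : ℕ) : Decidable (IsN ν p) :=
  inferInstanceAs (Decidable ((bar ν)[p]? = some Step.N))

/-- The positions `p` at which a valley starts: position `p` holds an `E`, `p + 1` an `N`. -/
def valleys (ν : List Step) : Finset ℕ :=
  (Finset.range (bar ν).length).filter fun p => IsE ν p ∧ IsN ν (p + 1)

/-- The number `w` of valleys of `E ν N`. -/
def numValleys (ν : List Step) : ℕ := (valleys ν).card

/-- The letter at position `p` is the first `N` of a run of `N`s: it repeats the index of the `E`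
that precedes it. -/
def RepeatsIndex (ν : List Step) (p : ℕ) : Prop := ∃ q ∈ valleys ν, p = q + 1

instance (ν : List Step) (p : ℕ) : Decidable (RepeatsIndex ν p) :=
  inferInstanceAs (Decidable (∃ q ∈ valleys ν, p = q + 1))

/-- The canonical index of the letter at position `p`: every letter gets the next positive
integer, except that the first `N` of a run gets the index of the preceding `E`. -/
def index (ν : List Step) (p : ℕ) : ℕ :=
  ((Finset.range (p + 1)).filter fun q => ¬ RepeatsIndex ν q).card

/-- The number `n` of indices used; they are `1, …, n`. -/
def numVertices (ν : List Step) : ℕ :=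
  ((Finset.range (bar ν).length).filter fun q => ¬ RepeatsIndex ν q).card

/-- The set `I` of indices of the `E`s. -/
def setI (ν : List Step) : Finset ℕ :=
  ((Finset.range (bar ν).length).filter fun p => IsE ν p).image (index ν)

/-- The set `J` of indices of the `N`s. -/
def setJ (ν : List Step) : Finset ℕ :=
  ((Finset.range (bar ν).length).filter fun p => IsN ν p).image (index ν)

/-- `v_{i+1}`: the index of the `(i+1)`-st valley, counted from the left (`i` starts at `0`). -/
def valleyIndex (ν : List Step) (i : Fin (numValleys ν)) : ℕ :=
  index ν ((valleys ν).orderEmbOfFin rfl i)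

/-! ### The graphs attached to a lattice path -/

/-- `(i, j)` is an edge of the `ν`-graph: `i < j`, there is a subword `E_i ⋯ N_j` of consecutive
letters, and each valley of this subword has index `i` or `j`. -/
def IsNuEdge (ν : List Step) (i j : ℕ) : Prop :=
  i < j ∧ ∃ p ∈ Finset.range (bar ν).length, ∃ q ∈ Finset.range (bar ν).length,
    p < q ∧ IsE ν p ∧ index ν p = i ∧ IsN ν q ∧ index ν q = j ∧
      ∀ r ∈ valleys ν, p ≤ r → r + 1 ≤ q → index ν r = i ∨ index ν r = j

instance (ν : List Step) (i j : ℕ) : Decidable (IsNuEdge ν i j) :=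
  inferInstanceAs (Decidable (_ ∧ _))

/-- The pairs of endpoints of the edges of the `ν`-graph. -/
def nuPairs (ν : List Step) : Finset (ℕ × ℕ) :=
  (Finset.Icc 1 (numVertices ν) ×ˢ Finset.Icc 1 (numVertices ν)).filter fun p =>
    IsNuEdge ν p.1 p.2

/-- The `ν`-graph `G(ν)`, with forward edges only. -/
def nuGraph (ν : List Step) : MixedGraph (numVertices ν) where
  edges := (nuPairs ν).image fun p => Edge.mk p.1 p.2 EdgeKind.forward

/-- The bidirectional `ν`-graph `G_B(ν)`: the edges between two elements of `I ∩ J` are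
bidirectional. -/
def nuGraphB (ν : List Step) : MixedGraph (numVertices ν) where
  edges := (nuPairs ν).image fun p =>
    Edge.mk p.1 p.2 (if p.1 ∈ setI ν ∩ setJ ν ∧ p.2 ∈ setI ν ∩ setJ ν
      then EdgeKind.bidirectional else EdgeKind.forward)

/-- The edge of the cycle `C_ν` that begins at the `(k+1)`-st valley: `(v_k, v_{k+1}, +)`, except
that the edge beginning at the last valley is `(v_1, v_w, -)`. -/
def cycleEdge (ν : List Step) (k : Fin (numValleys ν)) : Edge :=
  if h : k.1 + 1 < numValleys ν then
    Edge.mk (valleyIndex ν k) (valleyIndex ν ⟨k.1 + 1, h⟩) EdgeKind.forward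
  else
    Edge.mk (valleyIndex ν ⟨0, k.pos⟩) (valleyIndex ν k) EdgeKind.backward

/-- The graph `G(ν, i)`: the bidirectional path of `G_B(ν)` is replaced by the cycle `C_ν`
without its edge beginning at the `i`-th valley. -/
def nuGraphAt (ν : List Step) (i : Fin (numValleys ν)) : MixedGraph (numVertices ν) where
  edges := ((nuGraphB ν).edges.filter fun e => e.kind ≠ EdgeKind.bidirectional) ∪
    (Finset.univ.erase i).image (cycleEdge ν)

/-- Partial augmentation: a forward edge from the source to each element of `I` and a forward
edge from each element of `J` to the sink are added. -/
def partialAug (ν : List Step) (G : MixedGraph (numVertices ν)) :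
    MixedGraph (numVertices ν) where
  edges := G.edges ∪ ((setI ν).image fun i => Edge.mk 0 i EdgeKind.forward) ∪
    ((setJ ν).image fun j => Edge.mk j (numVertices ν + 1) EdgeKind.forward)

/-! ### The polytopes of the subdivision -/

/-- The bidirectional edge `(v_i, v_{i+1}, ±)` of `G_B(ν)`, for `i` not the last valley. -/
def pathEdge (ν : List Step) (i : Fin (numValleys ν)) (h : i.1 + 1 < numValleys ν) : Edge :=
  Edge.mk (valleyIndex ν i) (valleyIndex ν ⟨i.1 + 1, h⟩) EdgeKind.bidirectional

/-- The polytope `Q_i`, in the space of the flow polytope of the partially augmented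
bidirectional graph. If `i` is not the last valley, it is the convex hull of the routes that do
not traverse the edge `(v_i, v_{i+1}, ±)` from `v_i` to `v_{i+1}` and that, if they traverse any
edge backward, traverse this edge backward. For the last valley it is the flow polytope of the
partially augmented `ν`-graph; the coordinates of the two spaces are matched through the
endpoints of the edges. -/
def Q (ν : List Step) (i : Fin (numValleys ν)) :
    Set ((partialAug ν (nuGraphB ν)).edges → ℝ) :=
  if h : i.1 + 1 < numValleys ν then
    convexHull ℝ {x | ∃ R : List Arc, (partialAug ν (nuGraphB ν)).IsRoute R ∧
      Arc.mk (pathEdge ν i h) true ∉ R ∧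
      ((∃ c ∈ R, c.up = false) → Arc.mk (pathEdge ν i h) false ∈ R) ∧
      x = (partialAug ν (nuGraphB ν)).charVector R}
  else
    {x | ∃ y ∈ (partialAug ν (nuGraph ν)).flowPolytope,
      ∀ (e : (partialAug ν (nuGraphB ν)).edges) (e' : (partialAug ν (nuGraph ν)).edges),
        e.1.lo = e'.1.lo → e.1.hi = e'.1.hi → x e = y e'}

end SimplexSubdivision

namespace SimplexSubdivision

/-! ### The combinatorics of the canonical indexing -/

/-! The `ν`-graph is a caterpillar (`mem_nuPairs_iff`): the valleys form a path, and every other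
inner vertex is a leaf at one valley, its `block`. Hence a flow on the augmented bidirectional graph
is determined by two probability vectors, its flows out of the source and into the sink. The flow `X
l` on the path edge after the valley `l` is the difference of their partial sums over the blocks `≤
l` (`pathFlow_eq`). Put `X = 0` at the last valley, and let `region ν k` be the set of flows for
which `X` is minimal at `k`. A finite family has a minimum, so the regions cover the flow polytope.

The heart of the proof is that a region is the convex hull of its routes. Rotate the cyclic order of
the valleys so that `k` comes last. Then `X k ≤ X l` for all `l` says that the source vector
dominates the sink vector in all rotated partial sums. A greedy coupling (`exists_coupling`) turns
this into a convex combination of routes that enter at `i` and leave at `j` with `i` not after `j`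
in the rotated order, and such routes lie in the region (`exists_combination`). If a flow lies in
several regions, its values `X` at their indices agree. Averaging forces the same on each route
used, so intersections of regions are hulls of routes as well, and therefore lattice polytopes
(`iInter_region_eq_convexHull`). As a route has path flows in `{1, -1, 0}`, minimality at `k`
becomes the condition that defines `Q`; for the last valley it says `X ≥ 0` (`Q_eq_region`).

For the disjointness, each region contains a route at which `X` is strictly smallest at `k`. So `X k
< X l` holds on the whole relative interior, and two relative interiors cannot meet.

For the integral equivalence, the path is closed to a cycle. Subtracting a constant from `X` is then
a circulation and keeps the netflow. Subtracting the minimum, attained at all indices in `S`, gives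
a nonnegative flow on the cycle without the edges of `S`. Subtracting the value at the last valley
undoes this, and both maps are integral. -/

theorem isE_zero (ν : List Step) : IsE ν 0 := by simp [IsE, bar]

theorem isN_last (ν : List Step) : IsN ν (ν.length + 1) := by
  simp [IsN, bar]

theorem length_bar (ν : List Step) : (bar ν).length = ν.length + 2 := by simp [bar]

theorem IsE.lt {ν : List Step} {p : ℕ} (h : IsE ν p) : p < (bar ν).length :=
  (List.getElem?_eq_some_iff.1 h).1

theorem IsN.lt {ν : List Step} {p : ℕ} (h : IsN ν p) : p < (bar ν).length :=
  (List.getElem?_eq_some_iff.1 h).1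

theorem IsE.not_isN {ν : List Step} {p : ℕ} (h : IsE ν p) : ¬ IsN ν p := by
  intro h'
  have := h.symm.trans h'
  simp at this

theorem isE_or_isN {ν : List Step} {p : ℕ} (h : p < (bar ν).length) : IsE ν p ∨ IsN ν p := by
  unfold IsE IsN
  rw [List.getElem?_eq_getElem h]
  cases (bar ν)[p] <;> simp

theorem mem_valleys {ν : List Step} {p : ℕ} : p ∈ valleys ν ↔ IsE ν p ∧ IsN ν (p + 1) := by
  simp only [valleys, Finset.mem_filter, Finset.mem_range, and_iff_right_iff_imp]
  exact fun h => h.1.lt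

theorem mem_setI {ν : List Step} {i : ℕ} : i ∈ setI ν ↔ ∃ p, IsE ν p ∧ index ν p = i := by
  simp only [setI, Finset.mem_image, Finset.mem_filter, Finset.mem_range]
  exact ⟨fun ⟨p, h, h'⟩ => ⟨p, h.2, h'⟩, fun ⟨p, h, h'⟩ => ⟨p, ⟨h.lt, h⟩, h'⟩⟩

theorem mem_setJ {ν : List Step} {i : ℕ} : i ∈ setJ ν ↔ ∃ p, IsN ν p ∧ index ν p = i := by
  simp only [setJ, Finset.mem_image, Finset.mem_filter, Finset.mem_range]
  exact ⟨fun ⟨p, h, h'⟩ => ⟨p, h.2, h'⟩, fun ⟨p, h, h'⟩ => ⟨p, ⟨h.lt, h⟩, h'⟩⟩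

theorem repeatsIndex_succ {ν : List Step} {p : ℕ} : RepeatsIndex ν (p + 1) ↔ p ∈ valleys ν := by
  simp [RepeatsIndex]

theorem IsE.not_repeatsIndex {ν : List Step} {p : ℕ} (h : IsE ν p) : ¬ RepeatsIndex ν p := by
  rintro ⟨q, hq, rfl⟩
  exact h.not_isN (mem_valleys.1 hq).2

theorem index_mono (ν : List Step) : Monotone (index ν) := fun p q h =>
  Finset.card_le_card (Finset.filter_subset_filter _ (Finset.range_mono (by omega)))

theorem index_lt_of_not_repeatsIndex {ν : List Step} {p q r : ℕ} (hpr : p < r) (hrq : r ≤ q)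
    (h : ¬ RepeatsIndex ν r) : index ν p < index ν q := by
  refine Finset.card_lt_card (Finset.ssubset_iff_of_subset
    (Finset.filter_subset_filter _ (Finset.range_mono (by omega))) |>.2 ⟨r, ?_, ?_⟩)
  · simp only [Finset.mem_filter, Finset.mem_range]
    exact ⟨by omega, h⟩
  · simp only [Finset.mem_filter, Finset.mem_range]
    omega

theorem index_lt_of_isE {ν : List Step} {p q : ℕ} (hpq : p < q) (h : IsE ν q) :
    index ν p < index ν q :=
  index_lt_of_not_repeatsIndex hpq le_rfl h.not_repeatsIndex

theorem index_succ_of_mem_valleys {ν : List Step} {p : ℕ} (h : p ∈ valleys ν) :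
    index ν (p + 1) = index ν p := by
  unfold index
  rw [Finset.range_add_one (n := p + 1), Finset.filter_insert,
    if_neg (not_not.2 (repeatsIndex_succ.2 h))]

/-- No position after `p` up to `q` receives a new index. Two consecutive such positions are
impossible, since the first would have to hold both an `N` and the `E` of the next valley. -/
theorem mem_valleys_of_index_eq {ν : List Step} {p q : ℕ} (hpq : p < q)
    (h : index ν p = index ν q) : p ∈ valleys ν ∧ q = p + 1 := by
  have h1 : ∀ r, p < r → r ≤ q → RepeatsIndex ν r := fun r h1 h2 => by
    by_contra h3
    exact (index_lt_of_not_repeatsIndex h1 h2 h3).ne h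
  have h2 := repeatsIndex_succ.1 (h1 (p + 1) (by omega) (by omega))
  refine ⟨h2, ?_⟩
  by_contra h3
  have h4 := repeatsIndex_succ.1 (h1 (p + 2) (by omega) (by omega))
  exact (mem_valleys.1 h4).1.not_isN (mem_valleys.1 h2).2

theorem one_le_index (ν : List Step) (p : ℕ) : 1 ≤ index ν p := by
  refine Finset.card_pos.2 ⟨0, ?_⟩
  simp only [Finset.mem_filter, Finset.mem_range]
  exact ⟨by omega, (isE_zero ν).not_repeatsIndex⟩

theorem index_le_numVertices {ν : List Step} {p : ℕ} (hp : p < (bar ν).length) :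
    index ν p ≤ numVertices ν :=
  Finset.card_le_card (Finset.filter_subset_filter _ (Finset.range_mono (by omega)))

theorem setI_bounds {ν : List Step} {i : ℕ} (hi : i ∈ setI ν) : 1 ≤ i ∧ i ≤ numVertices ν := by
  obtain ⟨p, hp, rfl⟩ := mem_setI.1 hi
  exact ⟨one_le_index _ _, index_le_numVertices hp.lt⟩

theorem setJ_bounds {ν : List Step} {i : ℕ} (hi : i ∈ setJ ν) : 1 ≤ i ∧ i ≤ numVertices ν := by
  obtain ⟨p, hp, rfl⟩ := mem_setJ.1 hi
  exact ⟨one_le_index _ _, index_le_numVertices hp.lt⟩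

/-- An `E` always opens a new index, so an `N` can share it only by coming directly after it. -/
theorem mem_setI_and_setJ {ν : List Step} {v : ℕ} :
    (v ∈ setI ν ∧ v ∈ setJ ν) ↔ ∃ r ∈ valleys ν, index ν r = v := by
  constructor
  · rintro ⟨hI, hJ⟩
    obtain ⟨p, hp, rfl⟩ := mem_setI.1 hI
    obtain ⟨q, hq, hqp⟩ := mem_setJ.1 hJ
    rcases lt_trichotomy p q with h | h | h
    · exact ⟨p, (mem_valleys_of_index_eq h hqp.symm).1, rfl⟩
    · subst h
      exact absurd hq hp.not_isN
    · exact absurd hqp (index_lt_of_isE h hp).ne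
  · rintro ⟨r, hr, rfl⟩
    exact ⟨mem_setI.2 ⟨r, (mem_valleys.1 hr).1, rfl⟩,
      mem_setJ.2 ⟨r + 1, (mem_valleys.1 hr).2, index_succ_of_mem_valleys hr⟩⟩

theorem exists_valley_between {ν : List Step} {p q : ℕ} (hpq : p < q) (hp : IsE ν p)
    (hq : IsN ν q) : ∃ r ∈ valleys ν, p ≤ r ∧ r + 1 ≤ q := by
  induction q, hpq using Nat.le_induction with
  | base => exact ⟨p, mem_valleys.2 ⟨hp, hq⟩, le_rfl, le_rfl⟩
  | succ q hpq ih =>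
    rcases isE_or_isN (ν := ν) (p := q) (by have := hq.lt; omega) with h | h
    · exact ⟨q, mem_valleys.2 ⟨h, hq⟩, by omega, le_rfl⟩
    · obtain ⟨r, hr, h1, h2⟩ := ih h
      exact ⟨r, hr, h1, by omega⟩

theorem exists_mem_between {ν : List Step} {i j : ℕ} (hi : i ∈ setI ν) (hj : j ∈ setJ ν)
    (hij : i ≤ j) : ∃ v, (v ∈ setI ν ∧ v ∈ setJ ν) ∧ i ≤ v ∧ v ≤ j := by
  obtain ⟨p, hp, rfl⟩ := mem_setI.1 hi
  obtain ⟨q, hq, rfl⟩ := mem_setJ.1 hj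
  rcases lt_trichotomy p q with h | h | h
  · obtain ⟨r, hr, h1, h2⟩ := exists_valley_between h hp hq
    refine ⟨index ν r, mem_setI_and_setJ.2 ⟨r, hr, rfl⟩, index_mono ν h1, ?_⟩
    rw [← index_succ_of_mem_valleys hr]
    exact index_mono ν h2
  · subst h
    exact absurd hq hp.not_isN
  · exact absurd hij (index_lt_of_isE h hp).not_ge

/-- This eliminates the positions in the word: afterwards only `I`, `J` and the order of the indices
matter. -/
theorem isNuEdge_iff {ν : List Step} {i j : ℕ} :
    IsNuEdge ν i j ↔ i < j ∧ i ∈ setI ν ∧ j ∈ setJ ν ∧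
      ∀ v, (v ∈ setI ν ∧ v ∈ setJ ν) → i ≤ v → v ≤ j → v = i ∨ v = j := by
  constructor
  · rintro ⟨hij, p, -, q, -, hpq, hp, rfl, hq, rfl, h⟩
    refine ⟨hij, mem_setI.2 ⟨p, hp, rfl⟩, mem_setJ.2 ⟨q, hq, rfl⟩, fun v hv h1 h2 => ?_⟩
    obtain ⟨r, hr, rfl⟩ := mem_setI_and_setJ.1 hv
    refine h r hr ?_ ?_
    · by_contra hc
      exact (index_lt_of_isE (not_le.1 hc) hp).not_ge h1
    · by_contra hc
      rcases (show q ≤ r by omega).lt_or_eq with h' | rfl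
      · exact (index_lt_of_isE h' (mem_valleys.1 hr).1).not_ge h2
      · exact (mem_valleys.1 hr).1.not_isN hq
  · rintro ⟨hij, hi, hj, h⟩
    obtain ⟨p, hp, rfl⟩ := mem_setI.1 hi
    obtain ⟨q, hq, rfl⟩ := mem_setJ.1 hj
    refine ⟨hij, p, Finset.mem_range.2 hp.lt, q, Finset.mem_range.2 hq.lt,
      (index_mono ν).reflect_lt hij, hp, rfl, hq, rfl, fun r hr h1 h2 => ?_⟩
    refine h _ (mem_setI_and_setJ.2 ⟨r, hr, rfl⟩) (index_mono ν h1) ?_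
    rw [← index_succ_of_mem_valleys hr]
    exact index_mono ν h2

theorem mem_nuPairs {ν : List Step} {i j : ℕ} : (i, j) ∈ nuPairs ν ↔ IsNuEdge ν i j := by
  simp only [nuPairs, Finset.mem_filter, Finset.mem_product, Finset.mem_Icc,
    and_iff_right_iff_imp]
  intro h
  have := isNuEdge_iff.1 h
  exact ⟨setI_bounds this.2.1, setJ_bounds this.2.2.1⟩

theorem valleyIndex_strictMono (ν : List Step) : StrictMono (valleyIndex ν) := fun _ j h =>
  index_lt_of_isE (((valleys ν).orderEmbOfFin rfl).strictMono h)
    (mem_valleys.1 (Finset.orderEmbOfFin_mem _ rfl j)).1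

theorem mem_setI_and_setJ_iff {ν : List Step} {v : ℕ} :
    (v ∈ setI ν ∧ v ∈ setJ ν) ↔ ∃ k, valleyIndex ν k = v := by
  rw [mem_setI_and_setJ]
  constructor
  · rintro ⟨r, hr, rfl⟩
    have : r ∈ Set.range ((valleys ν).orderEmbOfFin rfl) := by
      rw [Finset.range_orderEmbOfFin]; exact hr
    obtain ⟨k, rfl⟩ := this
    exact ⟨k, rfl⟩
  · rintro ⟨k, rfl⟩
    exact ⟨_, Finset.orderEmbOfFin_mem _ rfl k, rfl⟩

theorem valleyIndex_mem_setI (ν : List Step) (k : Fin (numValleys ν)) :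
    valleyIndex ν k ∈ setI ν := (mem_setI_and_setJ_iff.2 ⟨k, rfl⟩).1

theorem valleyIndex_mem_setJ (ν : List Step) (k : Fin (numValleys ν)) :
    valleyIndex ν k ∈ setJ ν := (mem_setI_and_setJ_iff.2 ⟨k, rfl⟩).2

theorem exists_le_valleyIndex {ν : List Step} {i : ℕ} (hi : i ∈ setI ν) :
    ∃ k, i ≤ valleyIndex ν k := by
  obtain ⟨p, hp, rfl⟩ := mem_setI.1 hi
  have hp' := hp.lt
  rw [length_bar] at hp'
  obtain ⟨v, hv, h1, -⟩ := exists_mem_between hi (mem_setJ.2 ⟨_, isN_last ν, rfl⟩)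
    (index_mono ν (by omega))
  obtain ⟨k, rfl⟩ := mem_setI_and_setJ_iff.1 hv
  exact ⟨k, h1⟩

theorem exists_valleyIndex_le {ν : List Step} {j : ℕ} (hj : j ∈ setJ ν) :
    ∃ k, valleyIndex ν k ≤ j := by
  obtain ⟨q, hq, rfl⟩ := mem_setJ.1 hj
  obtain ⟨v, hv, -, h1⟩ := exists_mem_between (mem_setI.2 ⟨_, isE_zero ν, rfl⟩) hj
    (index_mono ν (by omega))
  obtain ⟨k, rfl⟩ := mem_setI_and_setJ_iff.1 hv
  exact ⟨k, h1⟩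

-- The word begins with `E` and ends with `N`, so it has a valley.
instance (ν : List Step) : NeZero (numValleys ν) := by
  obtain ⟨k, -⟩ := exists_le_valleyIndex (mem_setI.2 ⟨_, isE_zero ν, rfl⟩)
  exact ⟨k.pos.ne'⟩

/-! ### The valley to which a vertex is attached -/

/-- One function serves `I` and `J`: a vertex in both is itself a valley, and there the two
prescriptions agree. -/
theorem exists_block (ν : List Step) (u : ℕ) : ∃ b : Fin (numValleys ν),
    (u ∈ setI ν → u ≤ valleyIndex ν b ∧ ∀ k, u ≤ valleyIndex ν k → b ≤ k) ∧
    (u ∈ setJ ν → valleyIndex ν b ≤ u ∧ ∀ k, valleyIndex ν k ≤ u → k ≤ b) := by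
  have hm := valleyIndex_strictMono ν
  by_cases hI : u ∈ setI ν <;> by_cases hJ : u ∈ setJ ν
  · obtain ⟨k, rfl⟩ := mem_setI_and_setJ_iff.1 ⟨hI, hJ⟩
    exact ⟨k, fun _ => ⟨le_rfl, fun _ h => hm.le_iff_le.1 h⟩,
      fun _ => ⟨le_rfl, fun _ h => hm.le_iff_le.1 h⟩⟩
  · obtain ⟨b, hb, hb'⟩ := (Finset.univ.filter fun k => u ≤ valleyIndex ν k).exists_minimal
      ((exists_le_valleyIndex hI).imp fun k hk => by simpa using hk)
    simp only [Finset.mem_filter, Finset.mem_univ, true_and] at hb hb'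
    exact ⟨b, fun _ => ⟨hb, fun k hk => (le_total b k).elim id (hb' hk)⟩, fun h => absurd h hJ⟩
  · obtain ⟨b, hb, hb'⟩ := (Finset.univ.filter fun k => valleyIndex ν k ≤ u).exists_maximal
      ((exists_valleyIndex_le hJ).imp fun k hk => by simpa using hk)
    simp only [Finset.mem_filter, Finset.mem_univ, true_and] at hb hb'
    exact ⟨b, fun h => absurd h hI, fun _ => ⟨hb, fun k hk => (le_total k b).elim id (hb' hk)⟩⟩
  -- Outside `I ∪ J`, in particular at the source and the sink, the block is a meaningless default.
  · exact ⟨0, fun h => absurd h hI, fun h => absurd h hJ⟩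

/-- The valley to which the vertex `u` is attached: the first valley that is not before `u` if
`u ∈ I`, the last valley that is not after `u` if `u ∈ J`. -/
noncomputable def block (ν : List Step) (u : ℕ) : Fin (numValleys ν) := (exists_block ν u).choose

theorem le_valleyIndex_block {ν : List Step} {u : ℕ} (h : u ∈ setI ν) :
    u ≤ valleyIndex ν (block ν u) := ((exists_block ν u).choose_spec.1 h).1

theorem block_le {ν : List Step} {u : ℕ} (h : u ∈ setI ν) {k : Fin (numValleys ν)}
    (hk : u ≤ valleyIndex ν k) : block ν u ≤ k := ((exists_block ν u).choose_spec.1 h).2 k hk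

theorem valleyIndex_block_le {ν : List Step} {u : ℕ} (h : u ∈ setJ ν) :
    valleyIndex ν (block ν u) ≤ u := ((exists_block ν u).choose_spec.2 h).1

theorem le_block {ν : List Step} {u : ℕ} (h : u ∈ setJ ν) {k : Fin (numValleys ν)}
    (hk : valleyIndex ν k ≤ u) : k ≤ block ν u := ((exists_block ν u).choose_spec.2 h).2 k hk

@[simp] theorem block_valleyIndex (ν : List Step) (k : Fin (numValleys ν)) :
    block ν (valleyIndex ν k) = k :=
  le_antisymm (block_le (valleyIndex_mem_setI ν k) le_rfl)
    (le_block (valleyIndex_mem_setJ ν k) le_rfl)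

/-- The edges of the `ν`-graph form a caterpillar: each vertex of `I \ J` or of `J \ I` is a leaf
attached to its valley, and the valleys form a path. -/
theorem mem_nuPairs_iff {ν : List Step} {i j : ℕ} : (i, j) ∈ nuPairs ν ↔
    (i ∈ setI ν ∧ i ∉ setJ ν ∧ j = valleyIndex ν (block ν i)) ∨
    (j ∈ setJ ν ∧ j ∉ setI ν ∧ i = valleyIndex ν (block ν j)) ∨
    ∃ (k : Fin (numValleys ν)) (h : k.1 + 1 < numValleys ν),
      i = valleyIndex ν k ∧ j = valleyIndex ν ⟨k.1 + 1, h⟩ := by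
  have hm := valleyIndex_strictMono ν
  rw [mem_nuPairs, isNuEdge_iff]
  constructor
  · rintro ⟨hij, hi, hj, h⟩
    -- Some valley lies in `[i, j]`, and every valley there is an endpoint. An end that is not a
    -- valley is thus joined to its own block, and two valleys must be consecutive.
    obtain ⟨v, hv, h1, h2⟩ := exists_mem_between hi hj hij.le
    obtain ⟨k, rfl⟩ := mem_setI_and_setJ_iff.1 hv
    have hik := block_le hi h1
    have hkj := le_block hj h2
    by_cases hiJ : i ∈ setJ ν
    · obtain ⟨a, rfl⟩ := mem_setI_and_setJ_iff.1 ⟨hi, hiJ⟩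
      by_cases hjI : j ∈ setI ν
      · obtain ⟨b, rfl⟩ := mem_setI_and_setJ_iff.1 ⟨hjI, hj⟩
        have hab := hm.lt_iff_lt.1 hij
        have hlt : a.1 + 1 < numValleys ν := lt_of_le_of_lt (Fin.lt_def.1 hab) b.2
        refine Or.inr (Or.inr ⟨a, hlt, rfl, ?_⟩)
        rcases h _ (mem_setI_and_setJ_iff.2 ⟨⟨a.1 + 1, hlt⟩, rfl⟩)
          (hm.monotone (Fin.le_def.2 (by simp))) (hm.monotone (Fin.le_def.2 hab)) with h' | h'
        · have := congrArg Fin.val (hm.injective h')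
          simp at this
        · exact h'.symm
      · refine Or.inr (Or.inl ⟨hj, hjI, ?_⟩)
        have hb := valleyIndex_block_le hj
        rcases h _ (mem_setI_and_setJ_iff.2 ⟨block ν j, rfl⟩)
          (h1.trans (hm.monotone hkj)) hb with h' | h'
        · exact h'.symm
        · exact absurd (h' ▸ valleyIndex_mem_setI ν _) hjI
    · refine Or.inl ⟨hi, hiJ, ?_⟩
      rcases h _ (mem_setI_and_setJ_iff.2 ⟨block ν i, rfl⟩) (le_valleyIndex_block hi)
        ((hm.monotone hik).trans h2) with h' | h'
      · exact absurd (h' ▸ valleyIndex_mem_setJ ν _) hiJ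
      · exact h'.symm
  · rintro (⟨hi, hiJ, rfl⟩ | ⟨hj, hjI, rfl⟩ | ⟨k, hk, rfl, rfl⟩)
    · refine ⟨lt_of_le_of_ne (le_valleyIndex_block hi) fun h => hiJ ?_, hi,
        valleyIndex_mem_setJ _ _, fun v hv h1 h2 => Or.inr (le_antisymm h2 ?_)⟩
      · rw [h]; exact valleyIndex_mem_setJ ν _
      · obtain ⟨k, rfl⟩ := mem_setI_and_setJ_iff.1 hv
        exact hm.monotone (block_le hi h1)
    · refine ⟨lt_of_le_of_ne (valleyIndex_block_le hj) fun h => hjI ?_,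
        valleyIndex_mem_setI _ _, hj, fun v hv h1 h2 => Or.inl (le_antisymm ?_ h1)⟩
      · rw [← h]; exact valleyIndex_mem_setI ν _
      · obtain ⟨k, rfl⟩ := mem_setI_and_setJ_iff.1 hv
        exact hm.monotone (le_block hj h2)
    · refine ⟨hm (Fin.lt_def.2 (by simp)), valleyIndex_mem_setI _ _, valleyIndex_mem_setJ _ _,
        fun v hv h1 h2 => ?_⟩
      obtain ⟨m, rfl⟩ := mem_setI_and_setJ_iff.1 hv
      have h1 := Fin.le_def.1 (hm.le_iff_le.1 h1)
      have h2 := Fin.le_def.1 (hm.le_iff_le.1 h2)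
      simp only at h2
      rcases (show m.1 = k.1 ∨ m.1 = k.1 + 1 by omega) with h' | h'
      · exact Or.inl (by rw [show m = k from Fin.ext h'])
      · exact Or.inr (by rw [show m = ⟨k.1 + 1, hk⟩ from Fin.ext h'])


/-! ### Edges of the augmented graphs -/

/-- The forward edge from the source to `i`. -/
def sourceEdge (i : ℕ) : Edge := ⟨0, i, EdgeKind.forward⟩

/-- The forward edge from `j` to the sink. -/
def sinkEdge (ν : List Step) (j : ℕ) : Edge := ⟨j, numVertices ν + 1, EdgeKind.forward⟩

/-- The edge from a leaf in `I` to its valley. -/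
noncomputable def inEdge (ν : List Step) (i : ℕ) : Edge :=
  ⟨i, valleyIndex ν (block ν i), EdgeKind.forward⟩

/-- The edge to a leaf in `J` from its valley. -/
noncomputable def outEdge (ν : List Step) (j : ℕ) : Edge :=
  ⟨valleyIndex ν (block ν j), j, EdgeKind.forward⟩

/-- The edges between a valley and a leaf attached to it. -/
noncomputable def leafEdges (ν : List Step) : Finset Edge :=
  (setI ν \ setJ ν).image (inEdge ν) ∪ (setJ ν \ setI ν).image (outEdge ν)

/-- The edges that are common to all the partially augmented graphs. -/
noncomputable def baseEdges (ν : List Step) : Finset Edge :=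
  leafEdges ν ∪ (setI ν).image sourceEdge ∪ (setJ ν).image (sinkEdge ν)

/-- The edges of the cycle on the valleys, where the edges of the path have the kind `κ`. -/
def spineEdge (ν : List Step) (κ : EdgeKind) (l : Fin (numValleys ν)) : Edge :=
  if h : l.1 + 1 < numValleys ν then
    ⟨valleyIndex ν l, valleyIndex ν ⟨l.1 + 1, h⟩, κ⟩
  else ⟨valleyIndex ν ⟨0, l.pos⟩, valleyIndex ν l, EdgeKind.backward⟩

/-- The edges of `G` are the common ones and the edges of the cycle with index in `T`. -/
def IsSpineGraph (ν : List Step) (κ : EdgeKind) (T : Finset (Fin (numValleys ν)))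
    (G : MixedGraph (numVertices ν)) : Prop :=
  G.edges = baseEdges ν ∪ T.image (spineEdge ν κ)

/-- The indices of the edges of the path on the valleys. -/
def pathIndices (ν : List Step) : Finset (Fin (numValleys ν)) :=
  Finset.univ.filter fun l => l.1 + 1 < numValleys ν

theorem mem_leafEdges {ν : List Step} {e : Edge} : e ∈ leafEdges ν ↔
    (∃ i, (i ∈ setI ν ∧ i ∉ setJ ν) ∧ inEdge ν i = e) ∨
    (∃ j, (j ∈ setJ ν ∧ j ∉ setI ν) ∧ outEdge ν j = e) := by
  simp only [leafEdges, Finset.mem_union, Finset.mem_image, Finset.mem_sdiff]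

theorem mem_baseEdges {ν : List Step} {e : Edge} : e ∈ baseEdges ν ↔
    (∃ i, (i ∈ setI ν ∧ i ∉ setJ ν) ∧ inEdge ν i = e) ∨
    (∃ j, (j ∈ setJ ν ∧ j ∉ setI ν) ∧ outEdge ν j = e) ∨
    (∃ i ∈ setI ν, sourceEdge i = e) ∨ (∃ j ∈ setJ ν, sinkEdge ν j = e) := by
  simp only [baseEdges, Finset.mem_union, mem_leafEdges, Finset.mem_image, or_assoc]

/-- Path edges differ in their lower ends. The kind alone separates them from the last edge: for two
valleys both edges of the cycle have the same endpoints. -/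
theorem spineEdge_injective {ν : List Step} {κ : EdgeKind} (hκ : κ ≠ EdgeKind.backward) :
    Function.Injective (spineEdge ν κ) := by
  intro l m h
  have hv := (valleyIndex_strictMono ν).injective
  unfold spineEdge at h
  split_ifs at h with h1 h2 h2
  · exact hv (congrArg Edge.lo h)
  · exact absurd (congrArg Edge.kind h) hκ
  · exact absurd (congrArg Edge.kind h).symm hκ
  · exact hv (congrArg Edge.hi h)

theorem spineEdge_mem (ν : List Step) (κ : EdgeKind) (l : Fin (numValleys ν)) :
    (∃ a, (spineEdge ν κ l).lo = valleyIndex ν a) ∧ ∃ b, (spineEdge ν κ l).hi = valleyIndex ν b := by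
  unfold spineEdge
  split_ifs <;> exact ⟨⟨_, rfl⟩, ⟨_, rfl⟩⟩

/-- Each common edge has an end that is a leaf, the source or the sink, so it cannot join two
valleys. This keeps the common edges apart from the cycle. -/
theorem baseEdges_endpoint {ν : List Step} {e : Edge} (he : e ∈ baseEdges ν)
    {a b : Fin (numValleys ν)} (ha : e.lo = valleyIndex ν a) (hb : e.hi = valleyIndex ν b) :
    False := by
  have hI := valleyIndex_mem_setI ν
  have hJ := valleyIndex_mem_setJ ν
  rcases mem_baseEdges.1 he with ⟨i, h, rfl⟩ | ⟨j, h, rfl⟩ | ⟨i, h, rfl⟩ | ⟨j, h, rfl⟩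
  · exact h.2 (by rw [show i = _ from ha]; exact hJ a)
  · exact h.2 (by rw [show j = _ from hb]; exact hI b)
  · have := (setI_bounds (hI a)).1
    rw [← ha] at this
    simp [sourceEdge] at this
  · have := (setI_bounds (hI b)).2
    rw [← hb] at this
    simp [sinkEdge] at this

theorem spineEdge_notMem_baseEdges (ν : List Step) (κ : EdgeKind) (l : Fin (numValleys ν)) :
    spineEdge ν κ l ∉ baseEdges ν := by
  obtain ⟨⟨a, ha⟩, ⟨b, hb⟩⟩ := spineEdge_mem ν κ l
  exact fun h => baseEdges_endpoint h ha hb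

theorem kind_of_mem_baseEdges {ν : List Step} {e : Edge} (he : e ∈ baseEdges ν) :
    e.kind = EdgeKind.forward := by
  rcases mem_baseEdges.1 he with ⟨i, h, rfl⟩ | ⟨j, h, rfl⟩ | ⟨i, h, rfl⟩ | ⟨j, h, rfl⟩ <;> rfl

theorem lo_lt_hi_of_mem_baseEdges {ν : List Step} {e : Edge} (he : e ∈ baseEdges ν) :
    e.lo < e.hi := by
  rcases mem_baseEdges.1 he with ⟨i, h, rfl⟩ | ⟨j, h, rfl⟩ | ⟨i, h, rfl⟩ | ⟨j, h, rfl⟩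
  · exact (isNuEdge_iff.1 (mem_nuPairs.1 (mem_nuPairs_iff.2 (Or.inl ⟨h.1, h.2, rfl⟩)))).1
  · exact (isNuEdge_iff.1 (mem_nuPairs.1 (mem_nuPairs_iff.2 (Or.inr (Or.inl ⟨h.1, h.2, rfl⟩))))).1
  · exact (setI_bounds h).1
  · exact Nat.lt_succ_of_le (setJ_bounds h).2

/-! ### The augmented graphs as common edges plus a part of the cycle. -/

theorem image_nuPairs (ν : List Step) (κ : EdgeKind) :
    ((nuPairs ν).image fun p => Edge.mk p.1 p.2
      (if p.1 ∈ setI ν ∩ setJ ν ∧ p.2 ∈ setI ν ∩ setJ ν then κ else EdgeKind.forward)) =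
    leafEdges ν ∪ (pathIndices ν).image (spineEdge ν κ) := by
  ext e
  simp only [Finset.mem_image, Finset.mem_union, mem_leafEdges, Prod.exists, mem_nuPairs_iff,
    pathIndices, Finset.mem_filter, Finset.mem_univ, true_and, Finset.mem_inter]
  constructor
  · rintro ⟨i, j, ⟨hi, hiJ, rfl⟩ | ⟨hj, hjI, rfl⟩ | ⟨k, hk, rfl, rfl⟩, rfl⟩
    · exact Or.inl (Or.inl ⟨i, ⟨hi, hiJ⟩, by rw [if_neg (by tauto)]; rfl⟩)
    · exact Or.inl (Or.inr ⟨j, ⟨hj, hjI⟩, by rw [if_neg (by tauto)]; rfl⟩)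
    · refine Or.inr ⟨k, hk, ?_⟩
      rw [if_pos ⟨⟨valleyIndex_mem_setI ν _, valleyIndex_mem_setJ ν _⟩,
        ⟨valleyIndex_mem_setI ν _, valleyIndex_mem_setJ ν _⟩⟩, spineEdge, dif_pos hk]
  · rintro ((⟨i, ⟨hi, hiJ⟩, rfl⟩ | ⟨j, ⟨hj, hjI⟩, rfl⟩) | ⟨k, hk, rfl⟩)
    · exact ⟨_, _, Or.inl ⟨hi, hiJ, rfl⟩, by rw [if_neg (by tauto)]; rfl⟩
    · exact ⟨_, _, Or.inr (Or.inl ⟨hj, hjI, rfl⟩), by rw [if_neg (by tauto)]; rfl⟩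
    · refine ⟨_, _, Or.inr (Or.inr ⟨k, hk, rfl, rfl⟩), ?_⟩
      rw [if_pos ⟨⟨valleyIndex_mem_setI ν _, valleyIndex_mem_setJ ν _⟩,
        ⟨valleyIndex_mem_setI ν _, valleyIndex_mem_setJ ν _⟩⟩, spineEdge, dif_pos hk]

theorem isSpineGraph_partialAug {ν : List Step} {κ : EdgeKind} {T : Finset (Fin (numValleys ν))}
    {G : MixedGraph (numVertices ν)} (h : G.edges = leafEdges ν ∪ T.image (spineEdge ν κ)) :
    IsSpineGraph ν κ T (partialAug ν G) := by
  refine Finset.ext fun e => ?_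
  simp only [partialAug, h, baseEdges, Finset.mem_union]
  unfold sourceEdge sinkEdge
  tauto

theorem edges_nuGraphB (ν : List Step) : (nuGraphB ν).edges =
    leafEdges ν ∪ (pathIndices ν).image (spineEdge ν EdgeKind.bidirectional) :=
  image_nuPairs ν EdgeKind.bidirectional

theorem isSpineGraph_nuGraphB (ν : List Step) :
    IsSpineGraph ν EdgeKind.bidirectional (pathIndices ν) (partialAug ν (nuGraphB ν)) :=
  isSpineGraph_partialAug (edges_nuGraphB ν)

theorem isSpineGraph_nuGraph (ν : List Step) :
    IsSpineGraph ν EdgeKind.forward (pathIndices ν) (partialAug ν (nuGraph ν)) := by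
  refine isSpineGraph_partialAug ?_
  rw [← image_nuPairs]
  simp [nuGraph]

theorem isSpineGraph_nuGraphAt (ν : List Step) (i : Fin (numValleys ν)) :
    IsSpineGraph ν EdgeKind.forward (Finset.univ.erase i) (partialAug ν (nuGraphAt ν i)) := by
  refine isSpineGraph_partialAug ?_
  simp only [nuGraphAt, edges_nuGraphB]
  congr 1
  refine Finset.ext fun e => ?_
  simp only [Finset.mem_filter, Finset.mem_union, Finset.mem_image, pathIndices,
    Finset.mem_univ, true_and]
  constructor
  · rintro ⟨h | ⟨l, hl, rfl⟩, h'⟩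
    · exact h
    · exact absurd (by rw [spineEdge, dif_pos hl]) h'
  · intro h
    refine ⟨Or.inl h, ?_⟩
    rw [kind_of_mem_baseEdges (ν := ν) (by simp [baseEdges, h])]
    simp

theorem isSpineGraph_inter (ν : List Step) (S : Finset (Fin (numValleys ν))) (hS : S.Nonempty) :
    IsSpineGraph ν EdgeKind.forward Sᶜ
      (MixedGraph.inter (fun i => partialAug ν (nuGraphAt ν i)) S hS) := by
  refine Finset.ext fun e => ?_
  have h1 : e ∈ (MixedGraph.inter (fun i => partialAug ν (nuGraphAt ν i)) S hS).edges ↔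
      ∀ i ∈ S, e ∈ baseEdges ν ∪ (Finset.univ.erase i).image (spineEdge ν EdgeKind.forward) := by
    rw [MixedGraph.inter, Finset.mem_inf']
    refine forall₂_congr fun i _ => ?_
    rw [← isSpineGraph_nuGraphAt ν i]
  rw [h1]
  simp only [Finset.mem_union, Finset.mem_image, Finset.mem_erase, Finset.mem_univ, and_true,
    Finset.mem_compl]
  constructor
  · intro h
    by_cases he : e ∈ baseEdges ν
    · exact Or.inl he
    · obtain ⟨i, hi⟩ := hS
      obtain ⟨l, -, rfl⟩ := (h i hi).resolve_left he
      refine Or.inr ⟨l, fun hl => ?_, rfl⟩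
      -- If `l` were in `S`, the graph that omits the edge `l` would have to contain it.
      obtain ⟨m, hm, hml⟩ := (h l hl).resolve_left he
      exact hm (spineEdge_injective (by simp) hml)
  · rintro (h | ⟨l, hl, rfl⟩) i hi
    · exact Or.inl h
    · exact Or.inr ⟨l, fun h => hl (h ▸ hi), rfl⟩

/-! ### Netflow in terms of the common edges and the cycle -/

/-- Extension of a vector by zero to all edges. -/
def MixedGraph.extend {n : ℕ} (G : MixedGraph n) : (G.edges → ℝ) →ₗ[ℝ] (Edge → ℝ) :=
  LinearMap.pi fun e => if h : e ∈ G.edges then LinearMap.proj ⟨e, h⟩ else 0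

theorem MixedGraph.extend_of_mem {n : ℕ} {G : MixedGraph n} (x : G.edges → ℝ) {e : Edge}
    (h : e ∈ G.edges) : G.extend x e = x ⟨e, h⟩ := by
  simp [MixedGraph.extend, h]

theorem MixedGraph.extend_of_notMem {n : ℕ} {G : MixedGraph n} (x : G.edges → ℝ) {e : Edge}
    (h : e ∉ G.edges) : G.extend x e = 0 := by
  simp [MixedGraph.extend, h]

/-- The coefficient of the flow on `e` in the netflow at `u`. -/
def Edge.incidence (e : Edge) (u : ℕ) : ℝ :=
  (if e.lo = u then 1 else 0) - if e.hi = u then 1 else 0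

theorem MixedGraph.netflow_eq_sum {n : ℕ} (G : MixedGraph n) (x : G.edges → ℝ) (u : ℕ) :
    G.netflow x u = ∑ e ∈ G.edges, G.extend x e * e.incidence u := by
  rw [← Finset.sum_coe_sort, MixedGraph.netflow, ← Finset.sum_sub_distrib]
  refine Finset.sum_congr rfl fun e _ => ?_
  rw [MixedGraph.extend_of_mem x e.2, Edge.incidence]
  split_ifs <;> simp

/-- The successor of a valley in the cyclic order. -/
def nextValley {ν : List Step} (l : Fin (numValleys ν)) : Fin (numValleys ν) :=
  if h : l.1 + 1 < numValleys ν then ⟨l.1 + 1, h⟩ else ⟨0, l.pos⟩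

theorem nextValley_bijective (ν : List Step) :
    Function.Bijective (nextValley : Fin (numValleys ν) → Fin (numValleys ν)) := by
  refine Finite.injective_iff_bijective.1 fun l m h => ?_
  unfold nextValley at h
  split_ifs at h <;> simp at h <;> ext <;> omega

/-- The sign of an edge of the cycle: `1` on the path, `-1` on the last edge. -/
def spineSign {ν : List Step} (l : Fin (numValleys ν)) : ℝ :=
  if l.1 + 1 < numValleys ν then 1 else -1

theorem spineSign_mul_self {ν : List Step} (l : Fin (numValleys ν)) :
    spineSign l * spineSign l = 1 := by
  unfold spineSign
  split_ifs <;> norm_num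

/-- The sign reverses the edge from the first to the last valley, so that all edges of the cycle
point from a valley to its cyclic successor. -/
theorem incidence_spineEdge (ν : List Step) (κ : EdgeKind) (l : Fin (numValleys ν)) (u : ℕ) :
    (spineEdge ν κ l).incidence u = spineSign l *
      ((if valleyIndex ν l = u then 1 else 0) - if valleyIndex ν (nextValley l) = u then 1 else 0) := by
  unfold spineEdge spineSign nextValley Edge.incidence
  by_cases h : l.1 + 1 < numValleys ν <;> simp [h]

/-- The flow along the cycle: the flow on the path edges and minus the flow on the last edge. -/
def spineFlow (ν : List Step) (κ : EdgeKind) : (Edge → ℝ) →ₗ[ℝ] (Fin (numValleys ν) → ℝ) :=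
  LinearMap.pi fun l => spineSign l • LinearMap.proj (spineEdge ν κ l)

theorem spineFlow_apply (ν : List Step) (κ : EdgeKind) (f : Edge → ℝ) (l : Fin (numValleys ν)) :
    spineFlow ν κ f l = spineSign l * f (spineEdge ν κ l) := by
  simp [spineFlow]

/-- The netflow that comes from the flow on the common edges. -/
noncomputable def baseNet (ν : List Step) (f : Edge → ℝ) (u : ℕ) : ℝ :=
  ∑ e ∈ baseEdges ν, f e * e.incidence u

/-- The netflow that comes from the flow along the cycle. -/
def spineNet (ν : List Step) (X : Fin (numValleys ν) → ℝ) (u : ℕ) : ℝ :=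
  ∑ l, X l * ((if valleyIndex ν l = u then 1 else 0) -
    if valleyIndex ν (nextValley l) = u then 1 else 0)

/-- A constant flow around the cycle is a circulation and has netflow zero everywhere. -/
theorem spineNet_sub_const (ν : List Step) (X : Fin (numValleys ν) → ℝ) (c : ℝ) (u : ℕ) :
    spineNet ν (fun l => X l - c) u = spineNet ν X u := by
  have h : ∑ l : Fin (numValleys ν), ((if valleyIndex ν l = u then (1 : ℝ) else 0) -
      if valleyIndex ν (nextValley l) = u then 1 else 0) = 0 := by
    rw [Finset.sum_sub_distrib, (nextValley_bijective ν).sum_comp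
      fun l => if valleyIndex ν l = u then (1 : ℝ) else 0, sub_self]
  simp only [spineNet, sub_mul _ c, Finset.sum_sub_distrib (fun l => X l * _)]
  rw [← Finset.mul_sum, h, mul_zero, sub_zero]

namespace IsSpineGraph

variable {ν : List Step} {κ : EdgeKind} {T : Finset (Fin (numValleys ν))}
  {G : MixedGraph (numVertices ν)}

theorem mem_of_base (hG : IsSpineGraph ν κ T G) {e : Edge} (he : e ∈ baseEdges ν) :
    e ∈ G.edges := by
  rw [hG]; exact Finset.mem_union_left _ he

theorem mem_of_spine (hG : IsSpineGraph ν κ T G) {l : Fin (numValleys ν)} (hl : l ∈ T) :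
    spineEdge ν κ l ∈ G.edges := by
  rw [hG]; exact Finset.mem_union_right _ (Finset.mem_image_of_mem _ hl)

theorem notMem_of_spine (hG : IsSpineGraph ν κ T G) (hκ : κ ≠ EdgeKind.backward)
    {l : Fin (numValleys ν)} (hl : l ∉ T) : spineEdge ν κ l ∉ G.edges := by
  rw [hG, Finset.mem_union, Finset.mem_image]
  rintro (h | ⟨m, hm, h⟩)
  · exact spineEdge_notMem_baseEdges _ _ _ h
  · exact hl (spineEdge_injective hκ h ▸ hm)

theorem cases_edge (hG : IsSpineGraph ν κ T G) {e : Edge} (he : e ∈ G.edges) :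
    e ∈ baseEdges ν ∨ ∃ l ∈ T, spineEdge ν κ l = e := by
  rwa [hG, Finset.mem_union, Finset.mem_image] at he

theorem spineFlow_eq_zero (hG : IsSpineGraph ν κ T G) (hκ : κ ≠ EdgeKind.backward)
    (x : G.edges → ℝ) {l : Fin (numValleys ν)} (hl : l ∉ T) :
    spineFlow ν κ (G.extend x) l = 0 := by
  rw [spineFlow_apply, MixedGraph.extend_of_notMem x (hG.notMem_of_spine hκ hl), mul_zero]

theorem netflow_eq (hG : IsSpineGraph ν κ T G) (hκ : κ ≠ EdgeKind.backward)
    (x : G.edges → ℝ) (u : ℕ) :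
    G.netflow x u = baseNet ν (G.extend x) u + spineNet ν (spineFlow ν κ (G.extend x)) u := by
  rw [MixedGraph.netflow_eq_sum, Finset.sum_congr (show G.edges = _ from hG) fun _ _ => rfl,
    Finset.sum_union, baseNet, spineNet, Finset.sum_image (spineEdge_injective hκ).injOn]
  · congr 1
    rw [← Finset.sum_subset (Finset.subset_univ T)]
    · refine Finset.sum_congr rfl fun l _ => ?_
      rw [incidence_spineEdge, spineFlow_apply]
      ring
    · intro l _ hl
      rw [hG.spineFlow_eq_zero hκ x hl, zero_mul]
  · rw [Finset.disjoint_right]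
    intro e he
    obtain ⟨l, -, rfl⟩ := Finset.mem_image.1 he
    exact spineEdge_notMem_baseEdges _ _ _

end IsSpineGraph

/-- The netflow conditions, for a flow `f` on the common edges and `X` along the cycle. -/
def NetflowCondition (ν : List Step) (f : Edge → ℝ) (X : Fin (numValleys ν) → ℝ) : Prop :=
  ∀ u ≤ numVertices ν + 1, baseNet ν f u + spineNet ν X u =
    (if u = 0 then 1 else 0) - (if u = numVertices ν + 1 then 1 else 0)

/-- Flow conservation moves between graphs with different edges of the cycle, since it depends only
on the common edges and on `X` up to a constant. -/
theorem NetflowCondition.congr {ν : List Step} {f f' : Edge → ℝ} {X X' : Fin (numValleys ν) → ℝ}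
    (h : NetflowCondition ν f X) (hf : ∀ e ∈ baseEdges ν, f' e = f e) (c : ℝ)
    (hX : ∀ l, X' l = X l - c) : NetflowCondition ν f' X' := by
  intro u hu
  rw [← h u hu, ← spineNet_sub_const ν X c u, funext hX]
  congr 1
  exact Finset.sum_congr rfl fun e he => by rw [hf e he]

/-! ### Membership in the flow polytopes, in terms of the common edges and the cycle. -/

theorem spineFlow_last {ν : List Step} {κ : EdgeKind} {G : MixedGraph (numVertices ν)}
    (hG : IsSpineGraph ν κ (pathIndices ν) G) (hκ : κ ≠ EdgeKind.backward) (x : G.edges → ℝ)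
    {l : Fin (numValleys ν)} (hl : ¬ l.1 + 1 < numValleys ν) :
    spineFlow ν κ (G.extend x) l = 0 :=
  hG.spineFlow_eq_zero hκ x (by simpa [pathIndices] using hl)

theorem mem_flowPolytope_bidirectional {ν : List Step} {G : MixedGraph (numVertices ν)}
    (hG : IsSpineGraph ν EdgeKind.bidirectional (pathIndices ν) G) {x : G.edges → ℝ} :
    x ∈ G.flowPolytope ↔
      NetflowCondition ν (G.extend x) (spineFlow ν EdgeKind.bidirectional (G.extend x)) ∧
      ∀ e ∈ baseEdges ν, 0 ≤ G.extend x e := by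
  have hk : ∀ l ∈ pathIndices ν,
      (spineEdge ν EdgeKind.bidirectional l).kind = EdgeKind.bidirectional := by
    intro l hl
    simp only [pathIndices, Finset.mem_filter, Finset.mem_univ, true_and] at hl
    rw [spineEdge, dif_pos hl]
  simp only [MixedGraph.flowPolytope, Set.mem_ofPred_eq, hG.netflow_eq (by simp),
    NetflowCondition]
  refine and_congr_right fun _ => ⟨fun h e he => ?_, fun h => ⟨fun e he => ?_, fun e he => ?_⟩⟩
  · rw [MixedGraph.extend_of_mem x (hG.mem_of_base he)]
    exact h.1 _ (kind_of_mem_baseEdges he)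
  · rcases hG.cases_edge e.2 with h' | ⟨l, hl, h'⟩
    · have := h _ h'
      rwa [MixedGraph.extend_of_mem x e.2] at this
    · rw [← h', hk l hl] at he
      cases he
  · rcases hG.cases_edge e.2 with h' | ⟨l, hl, h'⟩
    · rw [kind_of_mem_baseEdges h'] at he
      cases he
    · rw [← h', hk l hl] at he
      cases he

/-- The sign in `spineFlow` turns the condition `x ≤ 0` on the backward edge into nonnegativity, and
absent edges carry zero. So the sign conditions on the cycle do not mention `T`. -/
theorem mem_flowPolytope_forward {ν : List Step} {T : Finset (Fin (numValleys ν))}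
    {G : MixedGraph (numVertices ν)} (hG : IsSpineGraph ν EdgeKind.forward T G)
    {x : G.edges → ℝ} :
    x ∈ G.flowPolytope ↔
      NetflowCondition ν (G.extend x) (spineFlow ν EdgeKind.forward (G.extend x)) ∧
      (∀ e ∈ baseEdges ν, 0 ≤ G.extend x e) ∧
      ∀ l, 0 ≤ spineFlow ν EdgeKind.forward (G.extend x) l := by
  simp only [MixedGraph.flowPolytope, Set.mem_ofPred_eq, hG.netflow_eq (by simp),
    NetflowCondition]
  refine and_congr_right fun _ =>
    ⟨fun h => ⟨fun e he => ?_, fun l => ?_⟩, fun h => ⟨fun e he => ?_, fun e he => ?_⟩⟩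
  · rw [MixedGraph.extend_of_mem x (hG.mem_of_base he)]
    exact h.1 _ (kind_of_mem_baseEdges he)
  · by_cases hl : l ∈ T
    · rw [spineFlow_apply, MixedGraph.extend_of_mem x (hG.mem_of_spine hl), spineSign]
      split_ifs with h'
      · rw [one_mul]
        exact h.1 _ (by simp [spineEdge, h'])
      · rw [neg_one_mul, neg_nonneg]
        exact h.2 _ (by simp [spineEdge, h'])
    · exact (hG.spineFlow_eq_zero (by simp) x hl).ge
  · rcases hG.cases_edge e.2 with h' | ⟨l, hl, h'⟩
    · have := h.1 _ h'
      rwa [MixedGraph.extend_of_mem x e.2] at this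
    · have h2 := h.2 l
      rw [spineFlow_apply, h', MixedGraph.extend_of_mem x e.2] at h2
      rw [← h', spineEdge] at he
      split_ifs at he with h3
      rwa [spineSign, if_pos h3, one_mul] at h2
  · rcases hG.cases_edge e.2 with h' | ⟨l, hl, h'⟩
    · rw [kind_of_mem_baseEdges h'] at he
      cases he
    · have h2 := h.2 l
      rw [spineFlow_apply, h', MixedGraph.extend_of_mem x e.2] at h2
      rw [← h', spineEdge] at he
      split_ifs at he with h3
      rwa [spineSign, if_neg h3, neg_one_mul, neg_nonneg] at h2

/-! ### Gluing a flow on the common edges and a flow along the cycle -/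

/-- The vector that agrees with `f` on the common edges and has the flow `X` along the cycle. -/
noncomputable def glue (ν : List Step) (κ : EdgeKind) (G : MixedGraph (numVertices ν)) :
    ((Edge → ℝ) × (Fin (numValleys ν) → ℝ)) →ₗ[ℝ] (G.edges → ℝ) :=
  LinearMap.pi fun e => if e.1 ∈ baseEdges ν then LinearMap.proj e.1 ∘ₗ LinearMap.fst ℝ _ _
    else (∑ l, if spineEdge ν κ l = e.1 then spineSign l • LinearMap.proj l else 0) ∘ₗ
      LinearMap.snd ℝ _ _

section glue

variable {ν : List Step} {κ : EdgeKind} {T : Finset (Fin (numValleys ν))}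
  {G : MixedGraph (numVertices ν)}

theorem extend_glue_base (hG : IsSpineGraph ν κ T G) (f : Edge → ℝ)
    (X : Fin (numValleys ν) → ℝ) {e : Edge} (he : e ∈ baseEdges ν) :
    G.extend (glue ν κ G (f, X)) e = f e := by
  rw [MixedGraph.extend_of_mem _ (hG.mem_of_base he)]
  simp [glue, he]

theorem glue_spine (hκ : κ ≠ EdgeKind.backward) (f : Edge → ℝ)
    (X : Fin (numValleys ν) → ℝ) {l : Fin (numValleys ν)} (hl : spineEdge ν κ l ∈ G.edges) :
    glue ν κ G (f, X) ⟨spineEdge ν κ l, hl⟩ = spineSign l * X l := by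
  have h : ∀ m, spineEdge ν κ m = spineEdge ν κ l ↔ m = l :=
    fun m => (spineEdge_injective hκ).eq_iff
  simp [glue, spineEdge_notMem_baseEdges, h]

/-- `X` must vanish outside `T`, because those edges have no coordinate in which the value could be
stored. -/
theorem spineFlow_glue (hG : IsSpineGraph ν κ T G) (hκ : κ ≠ EdgeKind.backward) (f : Edge → ℝ)
    {X : Fin (numValleys ν) → ℝ} (hX : ∀ l ∉ T, X l = 0) :
    spineFlow ν κ (G.extend (glue ν κ G (f, X))) = X := by
  funext l
  by_cases hl : l ∈ T
  · rw [spineFlow_apply, MixedGraph.extend_of_mem _ (hG.mem_of_spine hl), glue_spine hκ,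
      ← mul_assoc, spineSign_mul_self, one_mul]
  · rw [hG.spineFlow_eq_zero hκ _ hl, hX l hl]

theorem ext_of_extend (hG : IsSpineGraph ν κ T G) {x y : G.edges → ℝ}
    (hb : ∀ e ∈ baseEdges ν, G.extend x e = G.extend y e)
    (hs : ∀ l ∈ T, spineFlow ν κ (G.extend x) l = spineFlow ν κ (G.extend y) l) : x = y := by
  funext e
  rw [← MixedGraph.extend_of_mem x e.2, ← MixedGraph.extend_of_mem y e.2]
  rcases hG.cases_edge e.2 with h | ⟨l, hl, h⟩
  · exact hb _ h
  · have := hs l hl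
    rw [spineFlow_apply, spineFlow_apply, h] at this
    have h2 := congrArg (spineSign l * ·) this
    simpa only [← mul_assoc, spineSign_mul_self, one_mul] using h2

end glue


/-! ### A coupling along a linear order -/

/-- Two nonnegative vectors with the same sum, the first of which dominates the second in all
partial sums, have a coupling that is supported on the pairs in increasing order. -/
theorem exists_coupling {ι κ τ : Type*} [DecidableEq κ] [LinearOrder τ] (s : Finset ι) (p : ι → τ)
    (q : κ → τ) (β : κ → ℝ) (t : Finset κ) : ∀ α : ι → ℝ, (∀ i ∈ s, 0 ≤ α i) →
    (∀ j ∈ t, 0 ≤ β j) → ∑ i ∈ s, α i = ∑ j ∈ t, β j →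
    (∀ j ∈ t, ∑ j' ∈ t with q j' ≤ q j, β j' ≤ ∑ i ∈ s with p i ≤ q j, α i) →
    ∃ c : ι → κ → ℝ, (∀ i ∈ s, ∀ j ∈ t, 0 ≤ c i j) ∧ (∀ i ∈ s, ∑ j ∈ t, c i j = α i) ∧
      (∀ j ∈ t, ∑ i ∈ s, c i j = β j) ∧ ∀ i ∈ s, ∀ j ∈ t, c i j ≠ 0 → p i ≤ q j := by
  -- Greedy choice: the smallest target `j₀` is served first, from the sources not after it.
  induction t using Finset.induction_on_min_value q with
  | empty =>
    intro α hα _ hsum _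
    rw [Finset.sum_empty, Finset.sum_eq_zero_iff_of_nonneg hα] at hsum
    exact ⟨0, by simp, fun i hi => by simp [hsum i hi], by simp, by simp⟩
  | insert j₀ t hj₀ hmin ih =>
    intro α hα hβ hsum h
    have hβ₀ := hβ j₀ (Finset.mem_insert_self _ _)
    set A := ∑ i ∈ s with p i ≤ q j₀, α i with hA
    have hA₀ : β j₀ ≤ A := by
      refine le_trans ?_ (h j₀ (Finset.mem_insert_self _ _))
      refine Finset.single_le_sum (f := β) (fun j hj => hβ j (Finset.mem_filter.1 hj).1) ?_
      simp
    -- Each source not after `j₀` gives the same fraction `r` of its mass. If these sources have no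
    -- mass, then `β j₀ = 0` and `r = 0` works.
    obtain ⟨r, hr0, hr1, hrA⟩ : ∃ r : ℝ, 0 ≤ r ∧ r ≤ 1 ∧ r * A = β j₀ := by
      rcases (hβ₀.trans hA₀).eq_or_lt with h0 | h0
      · exact ⟨0, le_rfl, zero_le_one, by linarith⟩
      · exact ⟨β j₀ / A, div_nonneg hβ₀ h0.le, (div_le_one h0).2 hA₀, div_mul_cancel₀ _ h0.ne'⟩
    let μ : ι → ℝ := fun i => if p i ≤ q j₀ then r * α i else 0
    have hμ0 : ∀ i ∈ s, 0 ≤ μ i := fun i hi => by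
      simp only [μ]; split_ifs
      exacts [mul_nonneg hr0 (hα i hi), le_rfl]
    have hμα : ∀ i ∈ s, μ i ≤ α i := fun i hi => by
      simp only [μ]; split_ifs
      exacts [mul_le_of_le_one_left (hα i hi) hr1, hα i hi]
    have hμs : ∑ i ∈ s, μ i = β j₀ := by
      rw [← Finset.sum_filter, ← Finset.mul_sum, ← hA, hrA]
    -- All the mass that was used lies at or below `q j₀`, so from there on both partial sums drop
    -- by `β j₀` and the domination survives.
    have hμl : ∀ l, q j₀ ≤ l → ∑ i ∈ s with p i ≤ l, μ i = β j₀ := fun l hl => by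
      rw [← hμs]
      refine Finset.sum_subset (Finset.filter_subset _ _) fun i hi hil => if_neg fun hc => hil ?_
      exact Finset.mem_filter.2 ⟨hi, hc.trans hl⟩
    obtain ⟨c, hc0, hc1, hc2, hc3⟩ := ih (fun i => α i - μ i)
      (fun i hi => sub_nonneg.2 (hμα i hi)) (fun j hj => hβ j (Finset.mem_insert_of_mem hj))
      (by rw [Finset.sum_sub_distrib, hμs, hsum, Finset.sum_insert hj₀]; ring)
      (fun j hj => by
        have := h j (Finset.mem_insert_of_mem hj)
        rw [Finset.filter_insert, if_pos (hmin j hj), Finset.sum_insert (by simp [hj₀])] at this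
        rw [Finset.sum_sub_distrib, hμl _ (hmin j hj)]
        linarith)
    have hne : ∀ j ∈ t, j ≠ j₀ := fun j hj h => hj₀ (h ▸ hj)
    refine ⟨fun i j => if j = j₀ then μ i else c i j, ?_, ?_, ?_, ?_⟩
    · intro i hi j hj
      simp only
      split_ifs with hjj
      · exact hμ0 i hi
      · exact hc0 i hi j ((Finset.mem_insert.1 hj).resolve_left hjj)
    · intro i hi
      rw [Finset.sum_insert hj₀]
      beta_reduce
      rw [if_pos rfl,
        Finset.sum_congr rfl fun j hj => if_neg (hne j hj), hc1 i hi]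
      ring
    · intro j hj
      rcases Finset.mem_insert.1 hj with rfl | hj
      · simpa using hμs
      · simpa [hne j hj] using hc2 j hj
    · intro i hi j hj
      simp only
      split_ifs with hjj
      · intro hμ
        by_contra hc
        exact hμ (if_neg (hjj ▸ hc))
      · exact hc3 i hi j ((Finset.mem_insert.1 hj).resolve_left hjj)

/-! ### Routes are flows -/

namespace MixedGraph

variable {n : ℕ} {G : MixedGraph n}

theorem IsWalk.edge_mem {u z : ℕ} {R : List Arc} (h : G.IsWalk u R z) :
    ∀ c ∈ R, c.edge ∈ G.edges := by
  induction h with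
  | nil => simp
  | cons c R u hmem _ _ ih =>
    intro c' hc'
    rcases List.mem_cons.1 hc' with rfl | hc'
    exacts [hmem, ih c' hc']

theorem IsWalk.permitted {u z : ℕ} {R : List Arc} (h : G.IsWalk u R z) :
    ∀ c ∈ R, c.Permitted := by
  induction h with
  | nil => simp
  | cons c R u _ hdir _ ih =>
    intro c' hc'
    rcases List.mem_cons.1 hc' with rfl | hc'
    exacts [hdir, ih c' hc']

theorem IsWalk.endpoints_mem {u z : ℕ} {R : List Arc} (h : G.IsWalk u R z) :
    ∀ c ∈ R, c.edge.lo ∈ u :: R.map Arc.head ∧ c.edge.hi ∈ u :: R.map Arc.head := by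
  induction h with
  | nil => simp
  | cons c R u _ _ _ ih =>
    intro c' hc'
    rcases List.mem_cons.1 hc' with rfl | hc'
    · cases h : c'.up <;> simp [Arc.head, Arc.tail, h]
    · obtain ⟨h1, h2⟩ := ih c' hc'
      rw [List.map_cons]
      exact ⟨List.mem_cons_of_mem _ h1, List.mem_cons_of_mem _ h2⟩

/-- Both ends of an edge used by `R` are vertices of the walk `R`. Reusing the edge of `c` would
therefore revisit the tail of `c`. -/
theorem IsWalk.edge_ne {u : ℕ} {c : Arc} {R : List Arc} (h : G.IsWalk c.head R u)
    (hnd : (c.tail :: (c :: R).map Arc.head).Nodup) : ∀ c' ∈ R, c'.edge ≠ c.edge := by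
  intro c' hc' hcc
  obtain ⟨h1, h2⟩ := h.endpoints_mem c' hc'
  rw [hcc] at h1 h2
  refine (List.nodup_cons.1 hnd).1 ?_
  rw [List.map_cons]
  unfold Arc.tail
  split_ifs
  exacts [h1, h2]

theorem IsWalk.edge_injOn {u z : ℕ} {R : List Arc} (h : G.IsWalk u R z)
    (hnd : (u :: R.map Arc.head).Nodup) : ∀ c ∈ R, ∀ c' ∈ R, c.edge = c'.edge → c = c' := by
  induction h with
  | nil => simp
  | cons d R z _ _ hwalk ih =>
    have hne := hwalk.edge_ne hnd
    have ih := ih (List.nodup_cons.1 hnd).2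
    intro c hc c' hc' hcc
    rcases List.mem_cons.1 hc with h1 | h1 <;> rcases List.mem_cons.1 hc' with h2 | h2
    · rw [h1, h2]
    · exact absurd (h1 ▸ hcc.symm) (hne c' h2)
    · exact absurd (h2 ▸ hcc) (hne c h1)
    · exact ih c h1 c' h2 hcc

/-- The netflow of the signed characteristic vector of a path. -/
theorem IsWalk.netflow_charVector {u z : ℕ} {R : List Arc} (h : G.IsWalk u R z)
    (hnd : (u :: R.map Arc.head).Nodup) (j : ℕ) :
    G.netflow (G.charVector R) j = (if u = j then 1 else 0) - if z = j then 1 else 0 := by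
  induction h with
  | nil u => simp [netflow, charVector]
  | cons c R z hmem hdir hwalk ih =>
    have hne := hwalk.edge_ne hnd
    have ih := ih (List.nodup_cons.1 hnd).2
    -- The rest of the path avoids the edge of `c`, so prepending `c` adds a signed unit vector.
    have hsplit : G.charVector (c :: R) = fun e =>
        (if e = ⟨c.edge, hmem⟩ then (if c.up then 1 else -1) else 0) + G.charVector R e := by
      funext e
      by_cases he : e = ⟨c.edge, hmem⟩
      · subst he
        have h1 : ∀ b, Arc.mk c.edge b ∉ R := fun b hb => hne _ hb rfl
        obtain ⟨e, b⟩ := c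
        cases b <;> simp_all [charVector]
      · have h1 : ∀ b, Arc.mk e.1 b ≠ c := fun b hb => he (Subtype.ext (congrArg Arc.edge hb))
        simp [charVector, he, h1]
    have hlin : G.netflow (G.charVector (c :: R)) j = G.netflow (G.charVector R) j +
        ((if c.edge.lo = j then (if c.up then 1 else -1) else 0) -
          if c.edge.hi = j then (if c.up then 1 else -1) else 0) := by
      rw [hsplit]
      have h2 : ∀ (P : Edge → Prop) [DecidablePred P], (∑ e : G.edges, if P e.1 then
          ((if e = ⟨c.edge, hmem⟩ then (if c.up then (1 : ℝ) else -1) else 0) +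
            G.charVector R e) else 0) = (if P c.edge then (if c.up then 1 else -1) else 0) +
          ∑ e : G.edges, if P e.1 then G.charVector R e else 0 := by
        intro P _
        have h3 := Finset.sum_ite_eq' Finset.univ (⟨c.edge, hmem⟩ : G.edges)
          (fun e => if P e.1 then (if c.up then (1 : ℝ) else -1) else 0)
        rw [if_pos (Finset.mem_univ _)] at h3
        rw [← h3, ← Finset.sum_add_distrib]
        refine Finset.sum_congr rfl fun e _ => ?_
        split_ifs <;> simp
      rw [netflow, h2 fun e => e.lo = j, h2 fun e => e.hi = j, netflow]
      ring
    rw [hlin, ih]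
    unfold Arc.tail Arc.head
    cases c.up <;> simp
    split_ifs <;> ring

theorem IsRoute.charVector_mem {R : List Arc} (h : G.IsRoute R) :
    G.charVector R ∈ G.flowPolytope := by
  refine ⟨fun j _ => ?_, fun e he => ?_, fun e he => ?_⟩
  · rw [h.1.netflow_charVector h.2]
    simp only [eq_comm]
  · have h1 : Arc.mk e.1 false ∉ R := fun hc => by
      have := h.1.permitted _ hc
      simp [Arc.Permitted, he] at this
    simp only [charVector, if_neg h1]
    split_ifs <;> norm_num
  · have h1 : Arc.mk e.1 true ∉ R := fun hc => by
      have := h.1.permitted _ hc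
      simp [Arc.Permitted, he] at this
    simp only [charVector, if_neg h1]
    split_ifs <;> norm_num

theorem charVector_mem_values (R : List Arc) (e : G.edges) :
    G.charVector R e = 1 ∨ G.charVector R e = -1 ∨ G.charVector R e = 0 := by
  unfold charVector
  split_ifs <;> simp

theorem convex_flowPolytope (G : MixedGraph n) : Convex ℝ G.flowPolytope := by
  intro x hx y hy a b ha hb hab
  have hlin : ∀ j, G.netflow (a • x + b • y) j = a * G.netflow x j + b * G.netflow y j := by
    intro j
    have h : ∀ (P : Edge → Prop) [DecidablePred P], (∑ e : G.edges, if P e.1 then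
        (a • x + b • y) e else 0) = a * (∑ e : G.edges, if P e.1 then x e else 0) +
        b * ∑ e : G.edges, if P e.1 then y e else 0 := by
      intro P _
      rw [Finset.mul_sum, Finset.mul_sum, ← Finset.sum_add_distrib]
      refine Finset.sum_congr rfl fun e _ => ?_
      split_ifs <;> simp
    rw [netflow, h fun e => e.lo = j, h fun e => e.hi = j, netflow, netflow]
    ring
  refine ⟨fun j hj => ?_, fun e he => ?_, fun e he => ?_⟩
  · rw [hlin, hx.1 j hj, hy.1 j hj, ← add_mul, hab, one_mul]
  · have := hx.2.1 e he
    have := hy.2.1 e he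
    simp only [Pi.add_apply, Pi.smul_apply, smul_eq_mul]
    positivity
  · have h1 := mul_nonneg ha (neg_nonneg.2 (hx.2.2 e he))
    have h2 := mul_nonneg hb (neg_nonneg.2 (hy.2.2 e he))
    simp only [Pi.add_apply, Pi.smul_apply, smul_eq_mul]
    linarith

end MixedGraph

/-! ### Convexity -/

/-- From a point of the relative interior, one can move a little away from any point of the
set. -/
theorem exists_sub_mem_of_mem_intrinsicInterior {E : Type*} [NormedAddCommGroup E]
    [NormedSpace ℝ E] {s : Set E} {x z : E} (hx : x ∈ intrinsicInterior ℝ s) (hz : z ∈ s) :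
    ∃ ε : ℝ, 0 < ε ∧ x + ε • (x - z) ∈ s := by
  obtain ⟨y, hy, rfl⟩ := mem_intrinsicInterior.1 hx
  -- The line from `z` through `y`, parametrised so that positive `t` leads away from `z`. It stays
  -- in the affine span, where interior points can be perturbed.
  let f : ℝ → affineSpan ℝ s := fun t => ⟨AffineMap.lineMap (y : E) z (-t),
    AffineMap.lineMap_mem _ y.2 (subset_affineSpan ℝ s hz)⟩
  have hf : ∀ t, (f t : E) = y + t • ((y : E) - z) := by
    intro t
    simp only [f, AffineMap.lineMap_apply_module']
    module
  have hc : Continuous f := by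
    rw [continuous_induced_rng]
    have : (Subtype.val ∘ f) = fun t => (y : E) + t • ((y : E) - z) := funext hf
    rw [this]
    fun_prop
  have h0 : f 0 = y := Subtype.ext (by rw [hf]; simp)
  have hn : ∀ᶠ t in nhds (0 : ℝ), f t ∈ interior ((↑) ⁻¹' s : Set (affineSpan ℝ s)) :=
    hc.continuousAt.eventually (isOpen_interior.mem_nhds (h0.symm ▸ hy))
  obtain ⟨t, ht, ht0⟩ := ((hn.filter_mono nhdsWithin_le_nhds).and
    (self_mem_nhdsWithin (s := Set.Ioi (0 : ℝ)))).exists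
  exact ⟨t, ht0, by rw [← hf]; exact (interior_subset ht : f t ∈ ((↑) ⁻¹' s : Set (affineSpan ℝ s)))⟩

/-- Affine maps that preserve integer points and are inverse to each other on two polytopes give
an integral equivalence. -/
theorem integrallyEquivalent_of_inverse {ι κ : Type} {P : Set (ι → ℝ)} {R : Set (κ → ℝ)}
    (hP : IsLatticePolytope P) (φ : (ι → ℝ) →ᵃ[ℝ] (κ → ℝ)) (ψ : (κ → ℝ) →ᵃ[ℝ] (ι → ℝ))
    (hφ : Set.MapsTo φ (integerPoints ι) (integerPoints κ))
    (hψ : Set.MapsTo ψ (integerPoints κ) (integerPoints ι))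
    (hφP : Set.MapsTo φ P R) (hψR : Set.MapsTo ψ R P)
    (hψφ : ∀ x ∈ P, ψ (φ x) = x) (hφψ : ∀ y ∈ R, φ (ψ y) = y) : IntegrallyEquivalent P R := by
  have hbij : Set.BijOn φ P R := Set.InvOn.bijOn ⟨hψφ, hφψ⟩ hφP hψR
  have span : ∀ {ι κ : Type} {P : Set (ι → ℝ)} {R : Set (κ → ℝ)} (f : (ι → ℝ) →ᵃ[ℝ] (κ → ℝ)),
      Set.MapsTo f P R → Set.MapsTo f (affineSpan ℝ P) (affineSpan ℝ R) := by
    intro ι κ P R f hf x hx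
    have h1 : f x ∈ (affineSpan ℝ P).map f := ⟨x, hx, rfl⟩
    rw [AffineSubspace.map_span] at h1
    exact affineSpan_mono ℝ hf.image_subset h1
  -- Being inverse on the polytopes extends to their affine spans, because affine maps that agree on
  -- a set agree on its span.
  have idOn : ∀ {ι : Type} {P : Set (ι → ℝ)} (f : (ι → ℝ) →ᵃ[ℝ] (ι → ℝ)),
      (∀ x ∈ P, f x = x) → ∀ x ∈ affineSpan ℝ P, f x = x := by
    intro ι P f hf x hx
    have : Set.EqOn f (AffineMap.id ℝ (ι → ℝ)) (affineSpan ℝ P) :=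
      AffineMap.eqOn_affineSpan hf
    exact this hx
  refine ⟨hP, ?_, φ, hbij, Set.InvOn.bijOn (f' := ψ) ⟨fun x hx => ?_, fun y hy => ?_⟩ ?_ ?_⟩
  -- `R` is the image of `P`, hence the hull of the images of the integer points that span `P`.
  · classical
    obtain ⟨F, hF, rfl⟩ := hP
    refine ⟨F.image φ, ?_, ?_⟩
    · rw [Finset.coe_image]
      exact (hφ.mono_left hF).image_subset
    · rw [Finset.coe_image, ← φ.image_convexHull, hbij.image_eq]
  · exact idOn (ψ.comp φ) hψφ x hx.2
  · exact idOn (φ.comp ψ) hφψ y hy.2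
  · exact fun x hx => ⟨hφ hx.1, span φ hφP hx.2⟩
  · exact fun x hx => ⟨hψ hx.1, span ψ hψR hx.2⟩


/-! ### Flows on the common edges and along the cycle -/

section pairing

variable {ν : List Step}

theorem valleyIndex_bounds (ν : List Step) (l : Fin (numValleys ν)) :
    1 ≤ valleyIndex ν l ∧ valleyIndex ν l ≤ numVertices ν := setI_bounds (valleyIndex_mem_setI ν l)

theorem endpoints_le_of_mem_baseEdges {e : Edge} (he : e ∈ baseEdges ν) :
    e.lo ≤ numVertices ν + 1 ∧ e.hi ≤ numVertices ν + 1 := by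
  have hlt := lo_lt_hi_of_mem_baseEdges he
  suffices e.hi ≤ numVertices ν + 1 from ⟨by omega, this⟩
  rcases mem_baseEdges.1 he with ⟨i, h, rfl⟩ | ⟨j, h, rfl⟩ | ⟨i, h, rfl⟩ | ⟨j, h, rfl⟩
  · exact (valleyIndex_bounds ν _).2.trans (Nat.le_succ _)
  · exact (setJ_bounds h.1).2.trans (Nat.le_succ _)
  · exact (setI_bounds h).2.trans (Nat.le_succ _)
  · exact le_rfl

theorem sum_baseEdges (ν : List Step) (f : Edge → ℝ) : ∑ e ∈ baseEdges ν, f e =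
    ∑ i ∈ setI ν \ setJ ν, f (inEdge ν i) + ∑ j ∈ setJ ν \ setI ν, f (outEdge ν j) +
      ∑ i ∈ setI ν, f (sourceEdge i) + ∑ j ∈ setJ ν, f (sinkEdge ν j) := by
  have hI := valleyIndex_mem_setI ν
  rw [baseEdges, leafEdges, Finset.sum_union, Finset.sum_union, Finset.sum_union,
    Finset.sum_image fun _ _ _ _ h => congrArg Edge.lo h,
    Finset.sum_image fun _ _ _ _ h => congrArg Edge.hi h,
    Finset.sum_image fun _ _ _ _ h => congrArg Edge.hi h,
    Finset.sum_image fun _ _ _ _ h => congrArg Edge.lo h]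
  · rw [Finset.disjoint_left]
    intro e h1 h2
    obtain ⟨i, -, rfl⟩ := Finset.mem_image.1 h1
    obtain ⟨j, hj, h⟩ := Finset.mem_image.1 h2
    have h3 : j = valleyIndex ν (block ν i) := congrArg Edge.hi h
    exact (Finset.mem_sdiff.1 hj).2 (h3 ▸ hI _)
  · rw [Finset.disjoint_right]
    intro e h1 h2
    obtain ⟨i, -, rfl⟩ := Finset.mem_image.1 h1
    rw [Finset.mem_union] at h2
    rcases h2 with h2 | h2
    · obtain ⟨j, hj, h⟩ := Finset.mem_image.1 h2
      have h3 : j = 0 := congrArg Edge.lo h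
      have := (setI_bounds (Finset.mem_sdiff.1 hj).1).1
      omega
    · obtain ⟨j, hj, h⟩ := Finset.mem_image.1 h2
      have h3 : valleyIndex ν (block ν j) = 0 := congrArg Edge.lo h
      have := (valleyIndex_bounds ν (block ν j)).1
      omega
  · rw [Finset.disjoint_right]
    intro e h1 h2
    obtain ⟨i, -, rfl⟩ := Finset.mem_image.1 h1
    rw [Finset.mem_union, Finset.mem_union] at h2
    rcases h2 with (h2 | h2) | h2
    · obtain ⟨j, hj, h⟩ := Finset.mem_image.1 h2
      have h3 : valleyIndex ν (block ν j) = numVertices ν + 1 := congrArg Edge.hi h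
      have := (valleyIndex_bounds ν (block ν j)).2
      omega
    · obtain ⟨j, hj, h⟩ := Finset.mem_image.1 h2
      have h3 : j = numVertices ν + 1 := congrArg Edge.hi h
      have := (setJ_bounds (Finset.mem_sdiff.1 hj).1).2
      omega
    · obtain ⟨j, hj, h⟩ := Finset.mem_image.1 h2
      have h3 : j = numVertices ν + 1 := congrArg Edge.hi h
      have := (setI_bounds hj).2
      omega

theorem sum_potential_incidence (n : ℕ) (g : ℕ → ℝ) {a b : ℕ} (ha : a ≤ n + 1)
    (hb : b ≤ n + 1) : ∑ u ∈ Finset.range (n + 2),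
      g u * ((if a = u then 1 else 0) - if b = u then 1 else 0) = g a - g b := by
  simp only [mul_sub, Finset.sum_sub_distrib, mul_ite, mul_one, mul_zero, Finset.sum_ite_eq,
    Finset.mem_range]
  rw [if_pos (by omega), if_pos (by omega)]

variable {f : Edge → ℝ} {X : Fin (numValleys ν) → ℝ}

/-- Pairing of the netflow conditions with a potential. -/
theorem NetflowCondition.pairing (h : NetflowCondition ν f X) (g : ℕ → ℝ) :
    ∑ i ∈ setI ν \ setJ ν, f (inEdge ν i) * (g i - g (valleyIndex ν (block ν i))) +
    ∑ j ∈ setJ ν \ setI ν, f (outEdge ν j) * (g (valleyIndex ν (block ν j)) - g j) +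
    ∑ i ∈ setI ν, f (sourceEdge i) * (g 0 - g i) +
    ∑ j ∈ setJ ν, f (sinkEdge ν j) * (g j - g (numVertices ν + 1)) +
    ∑ l, X l * (g (valleyIndex ν l) - g (valleyIndex ν (nextValley l))) =
    g 0 - g (numVertices ν + 1) := by
  rw [← sum_potential_incidence (numVertices ν) g (Nat.zero_le _) le_rfl]
  have h1 : ∀ u ∈ Finset.range (numVertices ν + 2),
      g u * ((if 0 = u then 1 else 0) - if numVertices ν + 1 = u then 1 else 0) =
      g u * baseNet ν f u + g u * spineNet ν X u := by
    intro u hu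
    rw [← mul_add, h u (by rw [Finset.mem_range] at hu; omega)]
    simp only [eq_comm]
  rw [Finset.sum_congr rfl h1, Finset.sum_add_distrib]
  refine congrArg₂ (· + ·) ((sum_baseEdges ν fun e => f e * (g e.lo - g e.hi)).symm.trans ?_) ?_
  · simp only [baseNet, Finset.mul_sum]
    rw [Finset.sum_comm]
    refine Finset.sum_congr rfl fun e he => ?_
    obtain ⟨h2, h3⟩ := endpoints_le_of_mem_baseEdges he
    rw [← sum_potential_incidence _ g h2 h3, Finset.mul_sum]
    refine Finset.sum_congr rfl fun u _ => ?_
    rw [Edge.incidence]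
    ring
  · simp only [spineNet, Finset.mul_sum]
    rw [Finset.sum_comm]
    refine Finset.sum_congr rfl fun l _ => ?_
    rw [← sum_potential_incidence (numVertices ν) g
      ((valleyIndex_bounds ν l).2.trans (Nat.le_succ _))
      ((valleyIndex_bounds ν (nextValley l)).2.trans (Nat.le_succ _)), Finset.mul_sum]
    refine Finset.sum_congr rfl fun u _ => ?_
    ring

/-! ### Flow conservation at single vertices and across cuts. -/

theorem NetflowCondition.sum_source (h : NetflowCondition ν f X) :
    ∑ i ∈ setI ν, f (sourceEdge i) = 1 := by
  have hp := h.pairing fun u => if u = 0 then 1 else 0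
  have hv : ∀ l, valleyIndex ν l ≠ 0 := fun l => by have := (valleyIndex_bounds ν l).1; omega
  rw [Finset.sum_eq_zero (s := setI ν \ setJ ν), Finset.sum_eq_zero (s := setJ ν \ setI ν),
    Finset.sum_congr (s₁ := setI ν) (g := fun i => f (sourceEdge i)) rfl,
    Finset.sum_eq_zero (s := setJ ν), Finset.sum_eq_zero (s := Finset.univ)] at hp
  · simpa using hp
  · intro l _
    simp [hv]
  · intro j hj
    have := (setJ_bounds hj).1
    simp [show j ≠ 0 by omega]
  · intro j hj
    have := (setI_bounds hj).1
    simp [show j ≠ 0 by omega]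
  · intro j hj
    have := (setJ_bounds (Finset.mem_sdiff.1 hj).1).1
    simp [show j ≠ 0 by omega, hv]
  · intro j hj
    have := (setI_bounds (Finset.mem_sdiff.1 hj).1).1
    simp [show j ≠ 0 by omega, hv]

theorem NetflowCondition.sum_sink (h : NetflowCondition ν f X) :
    ∑ j ∈ setJ ν, f (sinkEdge ν j) = 1 := by
  have hp := h.pairing fun u => if u = numVertices ν + 1 then 1 else 0
  have hv : ∀ l, valleyIndex ν l ≠ numVertices ν + 1 := fun l => by
    have := (valleyIndex_bounds ν l).2
    omega
  rw [Finset.sum_eq_zero (s := setI ν \ setJ ν), Finset.sum_eq_zero (s := setJ ν \ setI ν),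
    Finset.sum_eq_zero (s := setI ν),
    Finset.sum_congr (s₁ := setJ ν) (g := fun j => - f (sinkEdge ν j)) rfl,
    Finset.sum_eq_zero (s := Finset.univ)] at hp
  · simpa using hp
  · intro l _
    simp [hv]
  · intro j hj
    have := (setJ_bounds hj).2
    simp [show j ≠ numVertices ν + 1 by omega]
  · intro j hj
    have := (setI_bounds hj).2
    simp [show j ≠ numVertices ν + 1 by omega]
  · intro j hj
    have := (setJ_bounds (Finset.mem_sdiff.1 hj).1).2
    simp [show j ≠ numVertices ν + 1 by omega, hv]
  · intro j hj
    have := (setI_bounds (Finset.mem_sdiff.1 hj).1).2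
    simp [show j ≠ numVertices ν + 1 by omega, hv]

theorem NetflowCondition.inEdge_eq (h : NetflowCondition ν f X) {i : ℕ} (hi : i ∈ setI ν)
    (hiJ : i ∉ setJ ν) : f (inEdge ν i) = f (sourceEdge i) := by
  -- At the leaf `i` only the edge from the source and the edge to its valley are incident.
  have hp := h.pairing fun u => if u = i then 1 else 0
  have hv : ∀ l, valleyIndex ν l ≠ i := fun l hl => hiJ (hl ▸ valleyIndex_mem_setJ ν l)
  have hb := setI_bounds hi
  have h0 : 0 ≠ i := by omega
  have h1 : numVertices ν + 1 ≠ i := by omega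
  rw [Finset.sum_eq_single_of_mem i (Finset.mem_sdiff.2 ⟨hi, hiJ⟩), Finset.sum_eq_zero,
    Finset.sum_eq_single_of_mem i hi, Finset.sum_eq_zero, Finset.sum_eq_zero] at hp
  · simp [hv, h0, h1] at hp
    linarith
  · intro l _
    simp [hv]
  · intro j hj
    simp [show j ≠ i from fun h => hiJ (h ▸ hj), h1]
  · intro j _ hj
    simp [hj, h0]
  · intro j hj
    simp [show j ≠ i from fun h => hiJ (h ▸ (Finset.mem_sdiff.1 hj).1), hv]
  · intro j _ hj
    simp [hj, hv]

theorem NetflowCondition.outEdge_eq (h : NetflowCondition ν f X) {j : ℕ} (hj : j ∈ setJ ν)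
    (hjI : j ∉ setI ν) : f (outEdge ν j) = f (sinkEdge ν j) := by
  have hp := h.pairing fun u => if u = j then 1 else 0
  have hv : ∀ l, valleyIndex ν l ≠ j := fun l hl => hjI (hl ▸ valleyIndex_mem_setI ν l)
  have hb := setJ_bounds hj
  have h0 : 0 ≠ j := by omega
  have h1 : numVertices ν + 1 ≠ j := by omega
  rw [Finset.sum_eq_zero, Finset.sum_eq_single_of_mem j (Finset.mem_sdiff.2 ⟨hj, hjI⟩),
    Finset.sum_eq_zero, Finset.sum_eq_single_of_mem j hj, Finset.sum_eq_zero] at hp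
  · simp [hv, h0, h1] at hp
    linarith
  · intro l _
    simp [hv]
  · intro i _ hi
    simp [hi, h1]
  · intro i hi
    simp [show i ≠ j from fun h => hjI (h ▸ hi), h0]
  · intro i _ hi
    simp [hi, hv]
  · intro i hi
    simp [show i ≠ j from fun h => hjI (h ▸ (Finset.mem_sdiff.1 hi).1), hv]

/-- The flow across the cut after the valley `l`. -/
theorem NetflowCondition.cut (h : NetflowCondition ν f X)
    (hX : ∀ l : Fin (numValleys ν), ¬ l.1 + 1 < numValleys ν → X l = 0)
    (l : Fin (numValleys ν)) :
    X l = (∑ i ∈ setI ν, if block ν i ≤ l then f (sourceEdge i) else 0) -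
      ∑ j ∈ setJ ν, if block ν j ≤ l then f (sinkEdge ν j) else 0 := by
  -- The potential is the indicator of the inner vertices in blocks `≤ l`. A leaf and its valley lie
  -- on the same side, so the leaf edges cancel. The bounds on `u` exclude the source and the sink,
  -- whose blocks are defaults.
  have hp := h.pairing fun u => if 1 ≤ u ∧ u ≤ numVertices ν ∧ block ν u ≤ l then 1 else 0
  -- Among the edges of the cycle, only `l` and the closing edge can cross the cut, and the closing
  -- edge carries no flow.
  have hs : ∑ m, X m * ((if m ≤ l then 1 else 0) - if nextValley m ≤ l then 1 else 0) = X l := by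
    rw [Finset.sum_eq_single_of_mem l (Finset.mem_univ _)]
    · by_cases hl : l.1 + 1 < numValleys ν
      · simp [nextValley, hl, Fin.le_def]
      · simp [hX l hl]
    · intro m _ hm
      by_cases hm' : m.1 + 1 < numValleys ν
      · have hm2 : m.1 ≠ l.1 := fun h => hm (Fin.ext h)
        have : m ≤ l ↔ nextValley m ≤ l := by
          simp only [nextValley, hm', dite_true, Fin.le_def]
          omega
        simp [this]
      · simp [hX m hm']
  have hv := valleyIndex_bounds ν
  simp only [block_valleyIndex, (hv _).1, (hv _).2, true_and] at hp
  rw [hs] at hp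
  rw [Finset.sum_eq_zero, Finset.sum_eq_zero, Finset.sum_congr (s₁ := setI ν)
    (g := fun i => - if block ν i ≤ l then f (sourceEdge i) else 0) rfl,
    Finset.sum_congr (s₁ := setJ ν)
    (g := fun j => if block ν j ≤ l then f (sinkEdge ν j) else 0) rfl] at hp
  · simp at hp
    linarith
  · intro j hj
    obtain ⟨h1, h2⟩ := setJ_bounds hj
    simp [h1, h2]
  · intro i hi
    obtain ⟨h1, h2⟩ := setI_bounds hi
    simp [h1, h2]
  · intro j hj
    obtain ⟨h1, h2⟩ := setJ_bounds (Finset.mem_sdiff.1 hj).1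
    simp [h1, h2]
  · intro i hi
    obtain ⟨h1, h2⟩ := setI_bounds (Finset.mem_sdiff.1 hi).1
    simp [h1, h2]

end pairing

/-! ### The bidirectional graph -/

/-- The partially augmented bidirectional `ν`-graph. -/
abbrev augB (ν : List Step) : MixedGraph (numVertices ν) := partialAug ν (nuGraphB ν)

/-- The flow on the path of bidirectional edges, with value zero at the last valley. -/
def pathFlow (ν : List Step) : ((augB ν).edges → ℝ) →ₗ[ℝ] (Fin (numValleys ν) → ℝ) :=
  spineFlow ν EdgeKind.bidirectional ∘ₗ (augB ν).extend

theorem spineEdge_bidirectional {ν : List Step} {l : Fin (numValleys ν)}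
    (hl : l.1 + 1 < numValleys ν) :
    spineEdge ν EdgeKind.bidirectional l = pathEdge ν l hl := by
  rw [spineEdge, dif_pos hl, pathEdge]

theorem pathEdge_mem {ν : List Step} {l : Fin (numValleys ν)}
    (hl : l.1 + 1 < numValleys ν) : pathEdge ν l hl ∈ (augB ν).edges := by
  rw [← spineEdge_bidirectional]
  exact (isSpineGraph_nuGraphB ν).mem_of_spine (by simp [pathIndices, hl])

theorem pathFlow_of_lt {ν : List Step} {l : Fin (numValleys ν)} (hl : l.1 + 1 < numValleys ν)
    (x : (augB ν).edges → ℝ) : pathFlow ν x l = x ⟨pathEdge ν l hl, pathEdge_mem hl⟩ := by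
  rw [pathFlow, LinearMap.comp_apply, spineFlow_apply, spineEdge_bidirectional hl,
    MixedGraph.extend_of_mem x (pathEdge_mem hl), spineSign, if_pos hl, one_mul]

theorem pathFlow_last {ν : List Step} {l : Fin (numValleys ν)}
    (hl : ¬ l.1 + 1 < numValleys ν) (x : (augB ν).edges → ℝ) : pathFlow ν x l = 0 :=
  spineFlow_last (isSpineGraph_nuGraphB ν) (by simp) x hl

theorem mem_flowPolytope_augB {ν : List Step} {x : (augB ν).edges → ℝ} :
    x ∈ (augB ν).flowPolytope ↔ NetflowCondition ν ((augB ν).extend x) (pathFlow ν x) ∧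
      ∀ e ∈ baseEdges ν, 0 ≤ (augB ν).extend x e :=
  mem_flowPolytope_bidirectional (isSpineGraph_nuGraphB ν)

theorem pathFlow_eq {ν : List Step} {x : (augB ν).edges → ℝ} (hx : x ∈ (augB ν).flowPolytope)
    (l : Fin (numValleys ν)) : pathFlow ν x l =
      (∑ i ∈ setI ν, if block ν i ≤ l then (augB ν).extend x (sourceEdge i) else 0) -
      ∑ j ∈ setJ ν, if block ν j ≤ l then (augB ν).extend x (sinkEdge ν j) else 0 :=
  (mem_flowPolytope_augB.1 hx).1.cut (fun _ hm => pathFlow_last hm x) l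

theorem sourceEdge_mem_baseEdges {ν : List Step} {i : ℕ} (hi : i ∈ setI ν) :
    sourceEdge i ∈ baseEdges ν := mem_baseEdges.2 (Or.inr (Or.inr (Or.inl ⟨i, hi, rfl⟩)))

theorem sinkEdge_mem_baseEdges {ν : List Step} {j : ℕ} (hj : j ∈ setJ ν) :
    sinkEdge ν j ∈ baseEdges ν := mem_baseEdges.2 (Or.inr (Or.inr (Or.inr ⟨j, hj, rfl⟩)))

/-- A flow is determined by the flow on the edges at the source and the sink. -/
theorem flow_ext {ν : List Step} {x y : (augB ν).edges → ℝ} (hx : x ∈ (augB ν).flowPolytope)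
    (hy : y ∈ (augB ν).flowPolytope)
    (hI : ∀ i ∈ setI ν, (augB ν).extend x (sourceEdge i) = (augB ν).extend y (sourceEdge i))
    (hJ : ∀ j ∈ setJ ν, (augB ν).extend x (sinkEdge ν j) = (augB ν).extend y (sinkEdge ν j)) :
    x = y := by
  have hx' := (mem_flowPolytope_augB.1 hx).1
  have hy' := (mem_flowPolytope_augB.1 hy).1
  refine ext_of_extend (isSpineGraph_nuGraphB ν) (fun e he => ?_) fun l _ => ?_
  · rcases mem_baseEdges.1 he with ⟨i, h, rfl⟩ | ⟨j, h, rfl⟩ | ⟨i, h, rfl⟩ | ⟨j, h, rfl⟩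
    · rw [hx'.inEdge_eq h.1 h.2, hy'.inEdge_eq h.1 h.2, hI i h.1]
    · rw [hx'.outEdge_eq h.1 h.2, hy'.outEdge_eq h.1 h.2, hJ j h.1]
    · exact hI i h
    · exact hJ j h
  · change pathFlow ν x l = pathFlow ν y l
    rw [pathFlow_eq hx, pathFlow_eq hy]
    refine congrArg₂ (· - ·) (Finset.sum_congr rfl fun i hi => ?_)
      (Finset.sum_congr rfl fun j hj => ?_)
    · rw [hI i hi]
    · rw [hJ j hj]

/-! ### Existence of routes -/

/-- There is a directed path from `u` to the sink with vertices in `A` that contains `c`. -/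
def MixedGraph.HasPath {n : ℕ} (G : MixedGraph n) (c : Arc) (u : ℕ) (A : ℕ → Prop) : Prop :=
  ∃ R, G.IsWalk u R (n + 1) ∧ (u :: R.map Arc.head).Nodup ∧
    (∀ a ∈ u :: R.map Arc.head, A a) ∧ c ∈ R

/-- The predicate `A` confines the path built so far, so a tail outside `A` cannot be a repeated
vertex. -/
theorem MixedGraph.HasPath.cons {n : ℕ} {G : MixedGraph n} {c : Arc} {u : ℕ} {A A' : ℕ → Prop}
    (h : G.HasPath c u A) (d : Arc) (hd : d.edge ∈ G.edges) (hp : d.Permitted) (hu : d.head = u)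
    (ht : ¬ A d.tail) (hA : ∀ a, a = d.tail ∨ A a → A' a) : G.HasPath c d.tail A' := by
  obtain ⟨R, h1, h2, h3, h4⟩ := h
  subst hu
  refine ⟨d :: R, .cons d R _ hd hp h1, ?_, ?_, List.mem_cons_of_mem _ h4⟩
  · rw [List.map_cons, List.nodup_cons]
    exact ⟨fun h => ht (h3 _ h), h2⟩
  · intro a ha
    rw [List.map_cons] at ha
    exact hA a ((List.mem_cons.1 ha).imp id (h3 a))

theorem MixedGraph.HasPath.mono {n : ℕ} {G : MixedGraph n} {c : Arc} {u : ℕ} {A A' : ℕ → Prop}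
    (h : G.HasPath c u A) (hA : ∀ a, A a → A' a) : G.HasPath c u A' := by
  obtain ⟨R, h1, h2, h3, h4⟩ := h
  exact ⟨R, h1, h2, fun a ha => hA a (h3 a ha), h4⟩

section routes

variable {ν : List Step}

theorem hasPath_block {j : ℕ} (hj : j ∈ setJ ν) :
    (augB ν).HasPath ⟨sinkEdge ν j, true⟩ (valleyIndex ν (block ν j)) fun a =>
      a = numVertices ν + 1 ∨ a = j ∨ a = valleyIndex ν (block ν j) := by
  have hG := isSpineGraph_nuGraphB ν
  have hb := setJ_bounds hj
  have h1 : (augB ν).HasPath ⟨sinkEdge ν j, true⟩ j fun a => a = numVertices ν + 1 ∨ a = j := by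
    refine ⟨[⟨sinkEdge ν j, true⟩], .cons ⟨sinkEdge ν j, true⟩ [] _
      (hG.mem_of_base (sinkEdge_mem_baseEdges hj)) (by simp [Arc.Permitted, sinkEdge]) (.nil _),
      ?_, ?_, ?_⟩
    · simp [Arc.head, sinkEdge]
      omega
    · simp [Arc.head, sinkEdge]
    · simp
  by_cases hjI : j ∈ setI ν
  · obtain ⟨k, rfl⟩ := mem_setI_and_setJ_iff.1 ⟨hjI, hj⟩
    rw [block_valleyIndex]
    exact h1.mono fun a ha => by tauto
  · refine h1.cons ⟨outEdge ν j, true⟩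
      (hG.mem_of_base (mem_baseEdges.2 (Or.inr (Or.inl ⟨j, ⟨hj, hjI⟩, rfl⟩))))
      (by simp [Arc.Permitted, outEdge]) (by simp [Arc.head, outEdge]) ?_ ?_
    · have h2 := (valleyIndex_bounds ν (block ν j)).2
      have h3 : valleyIndex ν (block ν j) ≠ j := fun h => hjI (h ▸ valleyIndex_mem_setI ν _)
      simp only [Arc.tail, outEdge, if_true]
      omega
    · simp only [Arc.tail, outEdge, if_true]
      tauto

theorem hasPath_valley {j : ℕ} (hj : j ∈ setJ ν) (a : Fin (numValleys ν)) :
    (augB ν).HasPath ⟨sinkEdge ν j, true⟩ (valleyIndex ν a) fun x =>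
      x = numVertices ν + 1 ∨ x = j ∨ ∃ m, x = valleyIndex ν m := by
  have hv := valleyIndex_strictMono ν
  have hne : ∀ k, valleyIndex ν k ≠ numVertices ν + 1 := fun k => by
    have := (valleyIndex_bounds ν k).2
    omega
  have hjb : ∀ k, valleyIndex ν k = j → k = block ν j := fun k hk => by
    rw [← hk, block_valleyIndex]
  rcases le_total a (block ν j) with h | h
  -- Induction on the distance to the block of `j`, walking up. The valleys visited are all `≥ a`,
  -- so the one prepended next is new.
  · have main : ∀ d : ℕ, ∀ a : Fin (numValleys ν), a.1 + d = (block ν j).1 →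
        (augB ν).HasPath ⟨sinkEdge ν j, true⟩ (valleyIndex ν a) fun x =>
          x = numVertices ν + 1 ∨ x = j ∨ ∃ m, a ≤ m ∧ x = valleyIndex ν m := by
      intro d
      induction d with
      | zero =>
        intro a ha
        obtain rfl : a = block ν j := Fin.ext ha
        refine (hasPath_block hj).mono fun x hx => ?_
        rcases hx with hx | hx | hx
        exacts [Or.inl hx, Or.inr (Or.inl hx), Or.inr (Or.inr ⟨_, le_rfl, hx⟩)]
      | succ d ih =>
        intro a ha
        have hlt : a.1 + 1 < numValleys ν := by have := (block ν j).2; omega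
        have := (ih ⟨a.1 + 1, hlt⟩ (by simp only; omega)).cons
          (A' := fun x => x = numVertices ν + 1 ∨ x = j ∨ ∃ m, a ≤ m ∧ x = valleyIndex ν m)
          ⟨pathEdge ν a hlt, true⟩ (pathEdge_mem hlt) (by simp [Arc.Permitted, pathEdge])
          (by simp [Arc.head, pathEdge]) ?_ ?_
        · simpa [Arc.tail, pathEdge] using this
        · simp only [Arc.tail, pathEdge, if_true]
          rintro (h1 | h1 | ⟨m, hm, h1⟩)
          · exact hne _ h1
          · have := hjb _ h1
            subst this
            omega
          · have := hv.injective h1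
            subst this
            simp [Fin.le_def] at hm
        · simp only [Arc.tail, pathEdge, if_true]
          rintro x (h1 | h1 | h1 | ⟨m, hm, h1⟩)
          · exact Or.inr (Or.inr ⟨a, le_rfl, h1⟩)
          · exact Or.inl h1
          · exact Or.inr (Or.inl h1)
          · exact Or.inr (Or.inr ⟨m, by simp only [Fin.le_def] at hm ⊢; omega, h1⟩)
    refine (main ((block ν j).1 - a.1) a (by have := Fin.le_def.1 h; omega)).mono ?_
    rintro x (h1 | h1 | ⟨m, -, h1⟩)
    exacts [Or.inl h1, Or.inr (Or.inl h1), Or.inr (Or.inr ⟨m, h1⟩)]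
  -- The mirror image: path edges are traversed backward, and the valleys visited are all `≤ a`.
  · have main : ∀ d : ℕ, ∀ a : Fin (numValleys ν), a.1 = (block ν j).1 + d →
        (augB ν).HasPath ⟨sinkEdge ν j, true⟩ (valleyIndex ν a) fun x =>
          x = numVertices ν + 1 ∨ x = j ∨ ∃ m, m ≤ a ∧ x = valleyIndex ν m := by
      intro d
      induction d with
      | zero =>
        intro a ha
        obtain rfl : a = block ν j := Fin.ext ha
        refine (hasPath_block hj).mono fun x hx => ?_
        rcases hx with hx | hx | hx
        exacts [Or.inl hx, Or.inr (Or.inl hx), Or.inr (Or.inr ⟨_, le_rfl, hx⟩)]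
      | succ d ih =>
        intro a ha
        obtain ⟨a, haw⟩ := a
        obtain ⟨a, rfl⟩ : ∃ a', a = a' + 1 := ⟨a - 1, by simp only at ha; omega⟩
        let a' : Fin (numValleys ν) := ⟨a, by omega⟩
        have := (ih a' (by simp only [a'] at ha ⊢; omega)).cons
          (A' := fun x => x = numVertices ν + 1 ∨ x = j ∨
            ∃ m, m ≤ ⟨a + 1, haw⟩ ∧ x = valleyIndex ν m)
          ⟨pathEdge ν a' haw, false⟩ (pathEdge_mem haw) (by simp [Arc.Permitted, pathEdge])
          (by simp [Arc.head, pathEdge]) ?_ ?_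
        · simpa [Arc.tail, pathEdge, a'] using this
        · simp only [Arc.tail, pathEdge, a', Bool.false_eq_true, if_false]
          rintro (h1 | h1 | ⟨m, hm, h1⟩)
          · exact hne _ h1
          · have := congrArg Fin.val (hjb _ h1)
            simp only at ha this
            omega
          · have := hv.injective h1
            subst this
            simp [Fin.le_def] at hm
        · simp only [Arc.tail, pathEdge, a', Bool.false_eq_true, if_false]
          rintro x (h1 | h1 | h1 | ⟨m, hm, h1⟩)
          · exact Or.inr (Or.inr ⟨_, le_rfl, h1⟩)
          · exact Or.inl h1
          · exact Or.inr (Or.inl h1)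
          · exact Or.inr (Or.inr ⟨m, by simp only [Fin.le_def] at hm ⊢; omega, h1⟩)
    refine (main (a.1 - (block ν j).1) a (by have := Fin.le_def.1 h; omega)).mono ?_
    rintro x (h1 | h1 | ⟨m, -, h1⟩)
    exacts [Or.inl h1, Or.inr (Or.inl h1), Or.inr (Or.inr ⟨m, h1⟩)]

theorem exists_route {i j : ℕ} (hi : i ∈ setI ν) (hj : j ∈ setJ ν) :
    ∃ R, (augB ν).IsRoute R ∧ ⟨sourceEdge i, true⟩ ∈ R ∧ ⟨sinkEdge ν j, true⟩ ∈ R := by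
  have hG := isSpineGraph_nuGraphB ν
  have hjb := (setJ_bounds hj).1
  have hib := setI_bounds hi
  have h1 : (augB ν).HasPath ⟨sinkEdge ν j, true⟩ i fun x => x ≠ 0 := by
    have h2 : ∀ x, (x = numVertices ν + 1 ∨ x = j ∨ ∃ m, x = valleyIndex ν m) → x ≠ 0 := by
      rintro x (h | h | ⟨m, h⟩)
      · omega
      · omega
      · have := (valleyIndex_bounds ν m).1
        omega
    by_cases hiJ : i ∈ setJ ν
    · obtain ⟨k, rfl⟩ := mem_setI_and_setJ_iff.1 ⟨hi, hiJ⟩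
      exact (hasPath_valley hj k).mono h2
    · refine (hasPath_valley hj (block ν i)).cons ⟨inEdge ν i, true⟩
        (hG.mem_of_base (mem_baseEdges.2 (Or.inl ⟨i, ⟨hi, hiJ⟩, rfl⟩)))
        (by simp [Arc.Permitted, inEdge]) (by simp [Arc.head, inEdge]) ?_ ?_
      · simp only [Arc.tail, inEdge, if_true]
        rintro (h | h | ⟨m, h⟩)
        · omega
        · exact hiJ (h ▸ hj)
        · exact hiJ (h ▸ valleyIndex_mem_setJ ν m)
      · rintro x (h | h)
        · simp only [Arc.tail, inEdge, if_true] at h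
          omega
        · exact h2 x h
  obtain ⟨R, h2, h3, h4, h5⟩ := h1
  refine ⟨⟨sourceEdge i, true⟩ :: R, ⟨.cons ⟨sourceEdge i, true⟩ R _
    (hG.mem_of_base (sourceEdge_mem_baseEdges hi)) (by simp [Arc.Permitted, sourceEdge]) h2, ?_⟩,
    List.mem_cons_self, List.mem_cons_of_mem _ h5⟩
  rw [List.map_cons, List.nodup_cons]
  exact ⟨fun h => h4 _ h rfl, h3⟩

/-- Applied to a route, whose unit flow on one source edge or sink edge excludes all the others. -/
theorem eq_ite_of_sum_eq_one {ι : Type*} [DecidableEq ι] {s : Finset ι} {f : ι → ℝ}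
    (h0 : ∀ i ∈ s, 0 ≤ f i) (h1 : ∑ i ∈ s, f i = 1) {i : ι} (hi : i ∈ s) (hfi : f i = 1) :
    ∀ i' ∈ s, f i' = if i' = i then 1 else 0 := by
  intro i' hi'
  split_ifs with h
  · rw [h, hfi]
  · have h2 := Finset.add_sum_erase s f hi
    rw [h1, hfi, add_eq_left, Finset.sum_eq_zero_iff_of_nonneg
      fun k hk => h0 k (Finset.mem_of_mem_erase hk)] at h2
    exact h2 i' (Finset.mem_erase.2 ⟨h, hi'⟩)

/-- For all `i ∈ I` and `j ∈ J` there is a route that leaves the source to `i` and enters the sink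
from `j`; this determines its signed characteristic vector. -/
theorem exists_route_charVector {i j : ℕ} (hi : i ∈ setI ν) (hj : j ∈ setJ ν) :
    ∃ R, (augB ν).IsRoute R ∧
      (∀ i' ∈ setI ν, (augB ν).extend ((augB ν).charVector R) (sourceEdge i') =
        if i' = i then 1 else 0) ∧
      (∀ j' ∈ setJ ν, (augB ν).extend ((augB ν).charVector R) (sinkEdge ν j') =
        if j' = j then 1 else 0) ∧
      ∀ l, pathFlow ν ((augB ν).charVector R) l =
        (if block ν i ≤ l then 1 else 0) - if block ν j ≤ l then 1 else 0 := by
  have hG := isSpineGraph_nuGraphB ν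
  obtain ⟨R, hR, h1, h2⟩ := exists_route hi hj
  have hF := hR.charVector_mem
  obtain ⟨hN, h0⟩ := mem_flowPolytope_augB.1 hF
  have hI := eq_ite_of_sum_eq_one (fun i' hi' => h0 _ (sourceEdge_mem_baseEdges hi'))
    hN.sum_source hi (by
      rw [MixedGraph.extend_of_mem _ (hG.mem_of_base (sourceEdge_mem_baseEdges hi))]
      exact if_pos h1)
  have hJ := eq_ite_of_sum_eq_one (fun j' hj' => h0 _ (sinkEdge_mem_baseEdges hj'))
    hN.sum_sink hj (by
      rw [MixedGraph.extend_of_mem _ (hG.mem_of_base (sinkEdge_mem_baseEdges hj))]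
      exact if_pos h2)
  refine ⟨R, hR, hI, hJ, fun l => ?_⟩
  -- The cut formula gives the path flow from the two end edges alone, without inspecting the walk.
  rw [pathFlow_eq hF]
  congr 1
  · rw [Finset.sum_eq_single_of_mem i hi, hI i hi, if_pos rfl]
    intro i' hi' hne
    rw [hI i' hi', if_neg hne, ite_self]
  · rw [Finset.sum_eq_single_of_mem j hj, hJ j hj, if_pos rfl]
    intro j' hj' hne
    rw [hJ j' hj', if_neg hne, ite_self]

end routes


/-! ### The regions of the subdivision -/

/-- The flows for which the flow on the path of bidirectional edges is minimal at `k`. -/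
def region (ν : List Step) (k : Fin (numValleys ν)) : Set ((augB ν).edges → ℝ) :=
  {x | x ∈ (augB ν).flowPolytope ∧ ∀ l, pathFlow ν x k ≤ pathFlow ν x l}

theorem convex_region (ν : List Step) (k : Fin (numValleys ν)) : Convex ℝ (region ν k) := by
  intro x hx y hy a b ha hb hab
  refine ⟨(augB ν).convex_flowPolytope hx.1 hy.1 ha hb hab, fun l => ?_⟩
  have h1 := mul_le_mul_of_nonneg_left (hx.2 l) ha
  have h2 := mul_le_mul_of_nonneg_left (hy.2 l) hb
  simp only [map_add, map_smul, Pi.add_apply, Pi.smul_apply, smul_eq_mul]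
  linarith

/-- The position of a valley in the cyclic order in which `k` is the last valley. -/
def rotate {ν : List Step} (k m : Fin (numValleys ν)) : ℕ :=
  if m ≤ k then m.1 + numValleys ν else m.1

/-- Summed against a probability vector, this expresses a rotated partial sum as the usual one at
`m` minus the one at `k`, plus a constant. The constant is the same for the source and the sink
vector and cancels in comparisons. -/
theorem rotate_le_indicator {ν : List Step} (k b m : Fin (numValleys ν)) :
    (if rotate k b ≤ rotate k m then (1 : ℝ) else 0) =
      (if b ≤ m then 1 else 0) - (if b ≤ k then 1 else 0) + if m ≤ k then 1 else 0 := by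
  have hb := b.2
  have hm := m.2
  unfold rotate
  simp only [Fin.le_def]
  split_ifs <;> first | omega | norm_num

/-- The two sides are the path flows at `k` and at `l` of a route from block `a` to block `b`. Such
a route is minimal at `k` once `a` is not after `b` in the rotated order. -/
theorem rotate_le_cut {ν : List Step} {k a b : Fin (numValleys ν)}
    (h : rotate k a ≤ rotate k b) (l : Fin (numValleys ν)) :
    ((if a ≤ k then (1 : ℝ) else 0) - if b ≤ k then 1 else 0) ≤
      (if a ≤ l then 1 else 0) - if b ≤ l then 1 else 0 := by
  have ha := a.2
  have hb := b.2
  unfold rotate at h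
  simp only [Fin.le_def] at h ⊢
  split_ifs at h ⊢ <;> first | omega | norm_num

/-- The signed characteristic vectors of routes. -/
def routeVectors (ν : List Step) : Set ((augB ν).edges → ℝ) :=
  {x | ∃ R, (augB ν).IsRoute R ∧ x = (augB ν).charVector R}

/-- A flow in the region of `k` is a convex combination of routes in this region. -/
theorem exists_combination {ν : List Step} {k : Fin (numValleys ν)}
    {x : (augB ν).edges → ℝ} (hx : x ∈ region ν k) :
    ∃ (s : Finset (ℕ × ℕ)) (c : ℕ × ℕ → ℝ) (r : ℕ × ℕ → (augB ν).edges → ℝ),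
      (∀ p ∈ s, 0 < c p) ∧ ∑ p ∈ s, c p = 1 ∧ (∀ p ∈ s, r p ∈ routeVectors ν ∧ r p ∈ region ν k) ∧
      x = ∑ p ∈ s, c p • r p := by
  have hxF := hx.1
  obtain ⟨hN, h0⟩ := mem_flowPolytope_augB.1 hxF
  have hα1 := hN.sum_source
  have hβ1 := hN.sum_sink
  set α : ℕ → ℝ := fun i => (augB ν).extend x (sourceEdge i) with hα
  set β : ℕ → ℝ := fun j => (augB ν).extend x (sinkEdge ν j) with hβ
  -- Rotated domination at `j` is the inequality between the path flows at `k` and at the block of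
  -- `j`.
  have hcut : ∀ j ∈ setJ ν,
      ∑ j' ∈ setJ ν with rotate k (block ν j') ≤ rotate k (block ν j), β j' ≤
      ∑ i ∈ setI ν with rotate k (block ν i) ≤ rotate k (block ν j), α i := by
    intro j _
    have hsum : ∀ (s : Finset ℕ) (f : ℕ → ℝ), ∑ i ∈ s, f i = 1 →
        ∑ i ∈ s with rotate k (block ν i) ≤ rotate k (block ν j), f i =
          (∑ i ∈ s, if block ν i ≤ block ν j then f i else 0) -
          (∑ i ∈ s, if block ν i ≤ k then f i else 0) + if block ν j ≤ k then 1 else 0 := by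
      intro s f hf
      have h1 : (if block ν j ≤ k then (1 : ℝ) else 0) =
          ∑ i ∈ s, f i * if block ν j ≤ k then 1 else 0 := by
        rw [← Finset.sum_mul, hf, one_mul]
      rw [h1, Finset.sum_filter, ← Finset.sum_sub_distrib, ← Finset.sum_add_distrib]
      refine Finset.sum_congr rfl fun i _ => ?_
      have h2 := congrArg (f i * ·) (rotate_le_indicator k (block ν i) (block ν j))
      simp only [mul_add, mul_sub, mul_ite, mul_one, mul_zero] at h2 ⊢
      exact h2
    rw [hsum _ _ hα1, hsum _ _ hβ1]
    have h1 := hx.2 (block ν j)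
    rw [pathFlow_eq hxF, pathFlow_eq hxF] at h1
    linarith
  obtain ⟨c, hc0, hcα, hcβ, hcr⟩ := exists_coupling (setI ν) (fun i => rotate k (block ν i))
    (fun j => rotate k (block ν j)) β (setJ ν) α
    (fun i hi => h0 _ (sourceEdge_mem_baseEdges hi)) (fun j hj => h0 _ (sinkEdge_mem_baseEdges hj))
    (hα1.trans hβ1.symm) hcut
  -- The memberships stand inside the existential so that `choose` gives a total function; the empty
  -- list is a dummy.
  have hr : ∀ i j, ∃ R, i ∈ setI ν → j ∈ setJ ν → (augB ν).IsRoute R ∧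
      (∀ i' ∈ setI ν, (augB ν).extend ((augB ν).charVector R) (sourceEdge i') =
        if i' = i then 1 else 0) ∧
      (∀ j' ∈ setJ ν, (augB ν).extend ((augB ν).charVector R) (sinkEdge ν j') =
        if j' = j then 1 else 0) ∧
      ∀ l, pathFlow ν ((augB ν).charVector R) l =
        (if block ν i ≤ l then 1 else 0) - if block ν j ≤ l then 1 else 0 := by
    intro i j
    by_cases hi : i ∈ setI ν
    · by_cases hj : j ∈ setJ ν
      · obtain ⟨R, h⟩ := exists_route_charVector hi hj
        exact ⟨R, fun _ _ => h⟩
      · exact ⟨[], fun _ h => absurd h hj⟩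
    · exact ⟨[], fun h => absurd h hi⟩
  choose R hR using hr
  let t := setI ν ×ˢ setJ ν
  let c' : ℕ × ℕ → ℝ := fun p => c p.1 p.2
  let r : ℕ × ℕ → (augB ν).edges → ℝ := fun p => (augB ν).charVector (R p.1 p.2)
  have ht : ∀ p ∈ t, p.1 ∈ setI ν ∧ p.2 ∈ setJ ν := fun p hp => Finset.mem_product.1 hp
  have hrF : ∀ p ∈ t, r p ∈ (augB ν).flowPolytope := fun p hp =>
    (hR p.1 p.2 (ht p hp).1 (ht p hp).2).1.charVector_mem
  have hc1 : ∑ p ∈ t, c' p = 1 := by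
    rw [Finset.sum_product, ← hα1]
    exact Finset.sum_congr rfl hcα
  have hc'0 : ∀ p ∈ t, 0 ≤ c' p := fun p hp => hc0 _ (ht p hp).1 _ (ht p hp).2
  -- Both sides are flows, so it suffices to compare source and sink edges; these are the marginals
  -- of the coupling.
  have hxr : x = ∑ p ∈ t, c' p • r p := by
    refine flow_ext hxF ((augB ν).convex_flowPolytope.sum_mem hc'0 hc1 hrF)
      (fun i hi => ?_) fun j hj => ?_
    · rw [map_sum, Finset.sum_apply, Finset.sum_product, Finset.sum_eq_single_of_mem i hi]
      · change α i = _
        rw [← hcα i hi]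
        refine Finset.sum_congr rfl fun j hj => ?_
        rw [map_smul, Pi.smul_apply, (hR i j hi hj).2.1 i hi]
        simp [c']
      · intro i' hi' hne
        refine Finset.sum_eq_zero fun j hj => ?_
        rw [map_smul, Pi.smul_apply, (hR i' j hi' hj).2.1 i hi, if_neg hne.symm, smul_zero]
    · rw [map_sum, Finset.sum_apply, Finset.sum_product_right, Finset.sum_eq_single_of_mem j hj]
      · change β j = _
        rw [← hcβ j hj]
        refine Finset.sum_congr rfl fun i hi => ?_
        rw [map_smul, Pi.smul_apply, (hR i j hi hj).2.2.1 j hj]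
        simp [c']
      · intro j' hj' hne
        refine Finset.sum_eq_zero fun i hi => ?_
        rw [map_smul, Pi.smul_apply, (hR i j' hi hj').2.2.1 j hj, if_neg hne.symm, smul_zero]
  -- Only pairs of nonzero weight are known to be in rotated order, so the others are dropped.
  refine ⟨t.filter fun p => c' p ≠ 0, c', r, ?_, ?_, ?_, ?_⟩
  · intro p hp
    obtain ⟨h1, h2⟩ := Finset.mem_filter.1 hp
    exact lt_of_le_of_ne (hc'0 p h1) h2.symm
  · rw [Finset.sum_filter_ne_zero, hc1]
  · intro p hp
    obtain ⟨h1, h2⟩ := Finset.mem_filter.1 hp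
    obtain ⟨hi, hj⟩ := ht p h1
    have hRp := hR p.1 p.2 hi hj
    refine ⟨⟨_, hRp.1, rfl⟩, hrF p h1, fun l => ?_⟩
    rw [hRp.2.2.2, hRp.2.2.2]
    exact rotate_le_cut (hcr _ hi _ hj h2) l
  · rw [Finset.sum_filter_of_ne]
    · exact hxr
    · intro p _ h1 h2
      exact h1 (by rw [h2, zero_smul])

/-- An intersection of regions is the convex hull of the routes that it contains. -/
theorem iInter_region_eq_convexHull (ν : List Step) {S : Finset (Fin (numValleys ν))}
    (hS : S.Nonempty) : ⋂ k ∈ S, region ν k =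
      convexHull ℝ (routeVectors ν ∩ ⋂ k ∈ S, region ν k) := by
  refine Set.Subset.antisymm (fun x hx => ?_) (convexHull_min Set.inter_subset_right
    (convex_iInter₂ fun k _ => convex_region ν k))
  simp only [Set.mem_iInter] at hx
  obtain ⟨k₀, hk₀⟩ := hS
  obtain ⟨s, c, r, hc0, hc1, hr, hxr⟩ := exists_combination (hx k₀ hk₀)
  rw [hxr]
  refine (convex_convexHull ℝ _).sum_mem (fun p hp => (hc0 p hp).le) hc1 fun p hp =>
    subset_convexHull ℝ _ ⟨(hr p hp).1, ?_⟩
  simp only [Set.mem_iInter]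
  intro k hk
  -- The path flow of `x` is equal at `k` and `k₀`. For each route the difference is nonnegative and
  -- its weight is positive, so every difference vanishes.
  have h1 : ∑ p ∈ s, c p * (pathFlow ν (r p) k - pathFlow ν (r p) k₀) = 0 := by
    have h2 : ∀ l, pathFlow ν x l = ∑ p ∈ s, c p * pathFlow ν (r p) l := by
      intro l
      rw [hxr, map_sum, Finset.sum_apply]
      exact Finset.sum_congr rfl fun p _ => by rw [map_smul, Pi.smul_apply, smul_eq_mul]
    simp only [mul_sub, Finset.sum_sub_distrib]
    rw [← h2, ← h2, sub_eq_zero]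
    exact le_antisymm ((hx k hk).2 k₀) ((hx k₀ hk₀).2 k)
  rw [Finset.sum_eq_zero_iff_of_nonneg fun p hp =>
    mul_nonneg (hc0 p hp).le (sub_nonneg.2 ((hr p hp).2.2 k))] at h1
  have h3 := (mul_eq_zero.1 (h1 p hp)).resolve_left (hc0 p hp).ne'
  refine ⟨(hr p hp).2.1, fun l => ?_⟩
  rw [sub_eq_zero.1 h3]
  exact (hr p hp).2.2 l

theorem finite_routeVectors (ν : List Step) : (routeVectors ν).Finite := by
  refine (Set.Finite.pi' (t := fun _ => ({1, -1, 0} : Set ℝ)) fun _ => by simp).subset ?_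
  rintro x ⟨R, -, rfl⟩ e
  simpa using MixedGraph.charVector_mem_values R e

theorem isLatticePolytope_iInter_region (ν : List Step) {S : Finset (Fin (numValleys ν))}
    (hS : S.Nonempty) : IsLatticePolytope (⋂ k ∈ S, region ν k) := by
  have hfin : (routeVectors ν ∩ ⋂ k ∈ S, region ν k).Finite :=
    (finite_routeVectors ν).subset Set.inter_subset_left
  refine ⟨hfin.toFinset, ?_, ?_⟩
  · rw [hfin.coe_toFinset]
    rintro x ⟨⟨R, -, rfl⟩, -⟩ e
    rcases MixedGraph.charVector_mem_values R e with h | h | h <;> rw [h]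
    exacts [⟨1, by simp⟩, ⟨-1, by simp⟩, ⟨0, by simp⟩]
  · rw [hfin.coe_toFinset]
    exact iInter_region_eq_convexHull ν hS

/-! ### The polytopes `Q` are the regions -/

/-- The path flow of a route has values in `{1, -1, 0}` and is `0` at the last valley. Minimality at
`k` thus excludes `1` there and demands `-1` as soon as `-1` occurs anywhere, which means that some
arc is traversed backward. -/
theorem charVector_mem_region_iff {ν : List Step} {k : Fin (numValleys ν)}
    (hk : k.1 + 1 < numValleys ν) {R : List Arc} (hR : (augB ν).IsRoute R) :
    (augB ν).charVector R ∈ region ν k ↔ Arc.mk (pathEdge ν k hk) true ∉ R ∧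
      ((∃ c ∈ R, c.up = false) → Arc.mk (pathEdge ν k hk) false ∈ R) := by
  have hG := isSpineGraph_nuGraphB ν
  set x := (augB ν).charVector R with hx
  let last : Fin (numValleys ν) := ⟨numValleys ν - 1, by have := k.2; omega⟩
  have hlast : pathFlow ν x last = 0 := pathFlow_last (by simp only [last]; omega) x
  have hxk : pathFlow ν x k = if Arc.mk (pathEdge ν k hk) true ∈ R then 1 else
      if Arc.mk (pathEdge ν k hk) false ∈ R then -1 else 0 := pathFlow_of_lt hk x
  have hval : ∀ l, -1 ≤ pathFlow ν x l := fun l => by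
    by_cases hl : l.1 + 1 < numValleys ν
    · rw [pathFlow_of_lt hl, hx]
      rcases MixedGraph.charVector_mem_values R ⟨_, pathEdge_mem hl⟩ with h | h | h <;> rw [h] <;>
        norm_num
    · rw [pathFlow_last hl]
      norm_num
  constructor
  · rintro ⟨-, h⟩
    have h1 : Arc.mk (pathEdge ν k hk) true ∉ R := fun hc => by
      have := h last
      rw [hlast, hxk, if_pos hc] at this
      norm_num at this
    refine ⟨h1, ?_⟩
    rintro ⟨⟨e, b⟩, hcR, rfl : b = false⟩
    have hp := hR.1.permitted _ hcR
    -- Common edges are forward, so a backward arc uses an edge of the path.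
    obtain ⟨l, hl, rfl⟩ : ∃ l ∈ pathIndices ν, spineEdge ν EdgeKind.bidirectional l = e := by
      refine (hG.cases_edge (hR.1.edge_mem _ hcR)).resolve_left fun hb => ?_
      simp only [Arc.Permitted, Bool.false_eq_true, if_false] at hp
      exact hp (kind_of_mem_baseEdges hb)
    have hl' : l.1 + 1 < numValleys ν := by simpa [pathIndices] using hl
    rw [spineEdge_bidirectional hl'] at hcR
    have hnot : Arc.mk (pathEdge ν l hl') true ∉ R := by
      intro hc
      have := hR.1.edge_injOn hR.2 _ hc _ hcR rfl
      simp at this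
    have hneg : pathFlow ν x l = -1 := by
      rw [pathFlow_of_lt hl']
      change (if _ ∈ R then (1 : ℝ) else if _ ∈ R then -1 else 0) = -1
      rw [if_neg hnot, if_pos hcR]
    have h2 := h l
    rw [hneg, hxk, if_neg h1] at h2
    by_contra hc
    rw [if_neg hc] at h2
    norm_num at h2
  · rintro ⟨h1, h2⟩
    refine ⟨hR.charVector_mem, fun l => ?_⟩
    rw [hxk, if_neg h1]
    split_ifs with h3
    · exact hval l
    · by_cases hl : l.1 + 1 < numValleys ν
      · rw [pathFlow_of_lt hl]
        change (0 : ℝ) ≤ if _ ∈ R then 1 else if _ ∈ R then -1 else 0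
        rw [if_neg (c := Arc.mk _ false ∈ R) fun hc => h3 (h2 ⟨_, hc, rfl⟩)]
        split_ifs <;> norm_num
      · exact (pathFlow_last hl x).ge

/-- Before the last valley both sides are hulls of the same routes. At the last valley the path flow
is zero, so minimality there means nonnegative path flow, as in the forward graph. -/
theorem Q_eq_region (ν : List Step) (k : Fin (numValleys ν)) : Q ν k = region ν k := by
  by_cases hk : k.1 + 1 < numValleys ν
  · have h := iInter_region_eq_convexHull ν (Finset.singleton_nonempty k)
    simp only [Finset.mem_singleton, Set.iInter_iInter_eq_left] at h
    rw [Q, dif_pos hk, h]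
    congr 1
    ext x
    constructor
    · rintro ⟨R, hR, h1, h2, rfl⟩
      exact ⟨⟨R, hR, rfl⟩, (charVector_mem_region_iff hk hR).2 ⟨h1, h2⟩⟩
    · rintro ⟨⟨R, hR, rfl⟩, h1⟩
      obtain ⟨h1, h2⟩ := (charVector_mem_region_iff hk hR).1 h1
      exact ⟨R, hR, h1, h2, rfl⟩
  · have hB := isSpineGraph_nuGraphB ν
    have hN := isSpineGraph_nuGraph ν
    have hlohi : ∀ l ∈ pathIndices ν, ∀ κ κ',
        (spineEdge ν κ l).lo = (spineEdge ν κ' l).lo ∧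
        (spineEdge ν κ l).hi = (spineEdge ν κ' l).hi := by
      intro l hl κ κ'
      simp only [pathIndices, Finset.mem_filter, Finset.mem_univ, true_and] at hl
      simp [spineEdge, hl]
    rw [Q, dif_neg hk]
    ext x
    constructor
    · rintro ⟨y, hy, hxy⟩
      obtain ⟨hy1, hy2, hy3⟩ := (mem_flowPolytope_forward hN).1 hy
      have hbase : ∀ e ∈ baseEdges ν,
          (augB ν).extend x e = (partialAug ν (nuGraph ν)).extend y e := fun e he => by
        rw [MixedGraph.extend_of_mem _ (hB.mem_of_base he),
          MixedGraph.extend_of_mem _ (hN.mem_of_base he)]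
        exact hxy _ _ rfl rfl
      have hpath : ∀ l, pathFlow ν x l =
          spineFlow ν EdgeKind.forward ((partialAug ν (nuGraph ν)).extend y) l := fun l => by
        by_cases hl : l ∈ pathIndices ν
        · rw [pathFlow, LinearMap.comp_apply, spineFlow_apply, spineFlow_apply,
            MixedGraph.extend_of_mem _ (hB.mem_of_spine hl),
            MixedGraph.extend_of_mem _ (hN.mem_of_spine hl)]
          congr 1
          exact hxy _ _ (hlohi l hl _ _).1 (hlohi l hl _ _).2
        · rw [hN.spineFlow_eq_zero (by simp) y hl]
          exact hB.spineFlow_eq_zero (by simp) x hl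
      refine ⟨mem_flowPolytope_augB.2 ⟨hy1.congr hbase 0 fun l => ?_, fun e he => ?_⟩,
        fun l => ?_⟩
      · rw [hpath, sub_zero]
      · rw [hbase e he]
        exact hy2 e he
      · rw [pathFlow_last hk, hpath]
        exact hy3 l
    · rintro ⟨hx, hxk⟩
      obtain ⟨hx1, hx2⟩ := mem_flowPolytope_augB.1 hx
      have hX : ∀ l ∉ pathIndices ν, pathFlow ν x l = 0 := fun l hl =>
        hB.spineFlow_eq_zero (by simp) x hl
      have hbase := fun (e : Edge) (he : e ∈ baseEdges ν) =>
        extend_glue_base hN ((augB ν).extend x) (pathFlow ν x) he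
      have hpath := spineFlow_glue hN (by simp) ((augB ν).extend x) hX
      refine ⟨glue ν EdgeKind.forward _ ((augB ν).extend x, pathFlow ν x),
        (mem_flowPolytope_forward hN).2 ⟨hx1.congr hbase 0 fun l => ?_, fun e he => ?_,
          fun l => ?_⟩, fun e e' hlo hhi => ?_⟩
      · rw [hpath, sub_zero]
      · rw [hbase e he]
        exact hx2 e he
      · rw [hpath, ← pathFlow_last hk x]
        exact hxk l
      · rw [← MixedGraph.extend_of_mem x e.2, ← MixedGraph.extend_of_mem
          (glue ν EdgeKind.forward _ ((augB ν).extend x, pathFlow ν x)) e'.2]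
        -- Endpoints identify edges across the two graphs: a common edge never joins two valleys,
        -- and a path edge is determined by its lower end.
        rcases hB.cases_edge e.2 with he | ⟨l, hl, he⟩ <;>
          rcases hN.cases_edge e'.2 with he' | ⟨m, hm, he'⟩
        · have : e.1 = e'.1 := by
            have h1 := kind_of_mem_baseEdges he
            have h2 := kind_of_mem_baseEdges he'
            generalize e.1 = a at *
            generalize e'.1 = b at *
            cases a
            cases b
            simp_all
          rw [this, hbase _ he']
        · obtain ⟨⟨a, ha⟩, ⟨b, hb⟩⟩ := spineEdge_mem ν EdgeKind.forward m
          rw [he'] at ha hb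
          exact (baseEdges_endpoint he (hlo.trans ha) (hhi.trans hb)).elim
        · obtain ⟨⟨a, ha⟩, ⟨b, hb⟩⟩ := spineEdge_mem ν EdgeKind.bidirectional l
          rw [he] at ha hb
          exact (baseEdges_endpoint he' (hlo.symm.trans ha) (hhi.symm.trans hb)).elim
        · have hlm : l = m := by
            have h1 : l.1 + 1 < numValleys ν := by simpa [pathIndices] using hl
            have h2 : m.1 + 1 < numValleys ν := by simpa [pathIndices] using hm
            rw [← he, ← he'] at hlo
            simp only [spineEdge, h1, h2, dite_true] at hlo
            exact (valleyIndex_strictMono ν).injective hlo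
          subst hlm
          have h1 := congrFun hpath l
          rw [spineFlow_apply, he', pathFlow, LinearMap.comp_apply, spineFlow_apply, he] at h1
          have h2 := congrArg (spineSign l * ·) h1
          simp only [← mul_assoc, spineSign_mul_self, one_mul] at h2
          exact h2.symm

/-! ### The subdivision -/

theorem flowPolytope_eq_iUnion_region (ν : List Step) :
    (augB ν).flowPolytope = ⋃ k, region ν k := by
  ext x
  simp only [Set.mem_iUnion]
  constructor
  · intro hx
    obtain ⟨k, hk⟩ := Finite.exists_min (pathFlow ν x)
    exact ⟨k, hx, hk⟩
  · rintro ⟨k, hx, -⟩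
    exact hx

/-- Each region contains a point at which the defining inequalities are strict. -/
theorem exists_strict_mem_region (ν : List Step) (k : Fin (numValleys ν)) :
    ∃ z ∈ region ν k, ∀ l, l ≠ k → pathFlow ν z k < pathFlow ν z l := by
  -- The route from the cyclic successor of `k` to `k`. If `k` is not last, its path flow is `-1` at
  -- `k` and `0` elsewhere; if `k` is last, it is `0` at `k` and `1` elsewhere.
  obtain ⟨R, hR, -, -, h⟩ := exists_route_charVector (valleyIndex_mem_setI ν (nextValley k))
    (valleyIndex_mem_setJ ν k)
  have hlt : ∀ l, l ≠ k → pathFlow ν ((augB ν).charVector R) k <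
      pathFlow ν ((augB ν).charVector R) l := by
    intro l hl
    have hl' : l.1 ≠ k.1 := fun h => hl (Fin.ext h)
    rw [h, h]
    have := l.2
    simp only [block_valleyIndex, nextValley, Fin.le_def]
    split_ifs <;> simp only [] at * <;> first | omega | norm_num
  refine ⟨_, ⟨hR.charVector_mem, fun l => ?_⟩, hlt⟩
  rcases eq_or_ne l k with rfl | hl
  exacts [le_rfl, (hlt l hl).le]

/-- Moving slightly away from a point where the inequality is strict would violate it if it were an
equality at `x`. -/
theorem lt_of_mem_intrinsicInterior_region {ν : List Step} {k l : Fin (numValleys ν)}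
    (hkl : l ≠ k) {x : (augB ν).edges → ℝ} (hx : x ∈ intrinsicInterior ℝ (region ν k)) :
    pathFlow ν x k < pathFlow ν x l := by
  obtain ⟨z, hz, hlt⟩ := exists_strict_mem_region ν k
  obtain ⟨ε, hε, h⟩ := exists_sub_mem_of_mem_intrinsicInterior hx hz
  have h1 := h.2 l
  have h2 := mul_pos hε (sub_pos.2 (hlt l hkl))
  simp only [map_add, map_smul, map_sub, Pi.add_apply, Pi.smul_apply, Pi.sub_apply,
    smul_eq_mul] at h1
  have h3 : 0 < (1 + ε) * (pathFlow ν x l - pathFlow ν x k) := by linarith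
  have := (pos_iff_pos_of_mul_pos h3).1 (by linarith)
  linarith

/-! ### Intersections of regions -/

theorem glue_mem_integerPoints {ν : List Step} {κ : EdgeKind} {T : Finset (Fin (numValleys ν))}
    {G : MixedGraph (numVertices ν)} (hG : IsSpineGraph ν κ T G) (hκ : κ ≠ EdgeKind.backward)
    {f : Edge → ℝ} {X : Fin (numValleys ν) → ℝ} (hf : ∀ e, ∃ m : ℤ, f e = m)
    (hX : ∀ l, ∃ m : ℤ, X l = m) : glue ν κ G (f, X) ∈ integerPoints G.edges := by
  rintro ⟨e, he⟩
  rcases hG.cases_edge he with h | ⟨l, hl, rfl⟩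
  · obtain ⟨m, hm⟩ := hf e
    refine ⟨m, ?_⟩
    rw [← MixedGraph.extend_of_mem (glue ν κ G (f, X)) he, extend_glue_base hG _ _ h, hm]
  · obtain ⟨m, hm⟩ := hX l
    rw [glue_spine hκ, hm, spineSign]
    split_ifs
    exacts [⟨m, by simp⟩, ⟨-m, by simp⟩]

theorem extend_integer {n : ℕ} {G : MixedGraph n} {x : G.edges → ℝ}
    (hx : x ∈ integerPoints G.edges) (e : Edge) : ∃ m : ℤ, G.extend x e = m := by
  by_cases he : e ∈ G.edges
  · rw [MixedGraph.extend_of_mem x he]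
    exact hx _
  · exact ⟨0, by rw [MixedGraph.extend_of_notMem x he, Int.cast_zero]⟩

theorem spineFlow_integer {ν : List Step} (κ : EdgeKind) {f : Edge → ℝ}
    (hf : ∀ e, ∃ m : ℤ, f e = m) (l : Fin (numValleys ν)) : ∃ m : ℤ, spineFlow ν κ f l = m := by
  obtain ⟨m, hm⟩ := hf (spineEdge ν κ l)
  rw [spineFlow_apply, hm, spineSign]
  split_ifs
  exacts [⟨m, by simp⟩, ⟨-m, by simp⟩]

/-- Subtraction of the value at `k`. -/
def shiftFlow {ν : List Step} (k : Fin (numValleys ν)) :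
    (Fin (numValleys ν) → ℝ) →ₗ[ℝ] (Fin (numValleys ν) → ℝ) :=
  { toFun := fun X l => X l - X k
    map_add' := fun X Y => by
      funext l
      simp only [Pi.add_apply]
      ring
    map_smul' := fun c X => by
      funext l
      simp only [Pi.smul_apply, smul_eq_mul, RingHom.id_apply]
      ring }

/-- The change of coordinates between two of the graphs: the flow on the common edges is kept,
and the flow along the cycle is shifted so that it vanishes at `k`. -/
noncomputable def shiftMap (ν : List Step) (κ κ' : EdgeKind) (G G' : MixedGraph (numVertices ν))
    (k : Fin (numValleys ν)) : (G.edges → ℝ) →ₗ[ℝ] (G'.edges → ℝ) :=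
  glue ν κ' G' ∘ₗ G.extend.prod
    (shiftFlow k ∘ₗ spineFlow ν κ ∘ₗ G.extend)

section shiftMap

variable {ν : List Step} {κ κ' : EdgeKind} {T T' : Finset (Fin (numValleys ν))}
  {G G' : MixedGraph (numVertices ν)}

theorem shiftMap_apply (k : Fin (numValleys ν)) (x : G.edges → ℝ) :
    shiftMap ν κ κ' G G' k x = glue ν κ' G' (G.extend x, fun l =>
      spineFlow ν κ (G.extend x) l - spineFlow ν κ (G.extend x) k) := rfl

theorem extend_shiftMap (hG' : IsSpineGraph ν κ' T' G') (k : Fin (numValleys ν))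
    (x : G.edges → ℝ) {e : Edge} (he : e ∈ baseEdges ν) :
    G'.extend (shiftMap ν κ κ' G G' k x) e = G.extend x e := by
  rw [shiftMap_apply, extend_glue_base hG' _ _ he]

/-- The hypothesis makes the shifted flow vanish on the edges absent from `G'`, so nothing is lost
in gluing. -/
theorem spineFlow_shiftMap (hG' : IsSpineGraph ν κ' T' G') (hκ' : κ' ≠ EdgeKind.backward)
    (k : Fin (numValleys ν)) {x : G.edges → ℝ}
    (hx : ∀ l ∉ T', spineFlow ν κ (G.extend x) l = spineFlow ν κ (G.extend x) k)
    (l : Fin (numValleys ν)) : spineFlow ν κ' (G'.extend (shiftMap ν κ κ' G G' k x)) l =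
      spineFlow ν κ (G.extend x) l - spineFlow ν κ (G.extend x) k := by
  rw [shiftMap_apply, spineFlow_glue hG' hκ' _ fun l hl => sub_eq_zero.2 (hx l hl)]

theorem shiftMap_mapsTo_integerPoints (hG' : IsSpineGraph ν κ' T' G')
    (hκ' : κ' ≠ EdgeKind.backward) (k : Fin (numValleys ν)) :
    Set.MapsTo (shiftMap ν κ κ' G G' k) (integerPoints G.edges) (integerPoints G'.edges) := by
  intro x hx
  rw [shiftMap_apply]
  have h := extend_integer hx
  refine glue_mem_integerPoints hG' hκ' h fun l => ?_
  obtain ⟨a, ha⟩ := spineFlow_integer κ h l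
  obtain ⟨b, hb⟩ := spineFlow_integer κ h k
  exact ⟨a - b, by rw [ha, hb, Int.cast_sub]⟩

/-- The second shift subtracts the already shifted value at `k'`. In total the value at `k'` is
subtracted, and it is zero. -/
theorem shiftMap_shiftMap (hG : IsSpineGraph ν κ T G) (hκ : κ ≠ EdgeKind.backward)
    (hG' : IsSpineGraph ν κ' T' G') (hκ' : κ' ≠ EdgeKind.backward) (k k' : Fin (numValleys ν))
    {x : G.edges → ℝ}
    (hx : ∀ l ∉ T', spineFlow ν κ (G.extend x) l = spineFlow ν κ (G.extend x) k)
    (hk' : ∀ l ∉ T, spineFlow ν κ (G.extend x) l = spineFlow ν κ (G.extend x) k')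
    (h0 : spineFlow ν κ (G.extend x) k' = 0) :
    shiftMap ν κ' κ G' G k' (shiftMap ν κ κ' G G' k x) = x := by
  have h := spineFlow_shiftMap hG' hκ' k hx
  refine ext_of_extend hG (fun e he => ?_) fun l _ => ?_
  · rw [extend_shiftMap hG _ _ he, extend_shiftMap hG' _ _ he]
  · rw [spineFlow_shiftMap hG hκ k' (fun l hl => by rw [h, h, hk' l hl]) l, h, h, h0]
    ring

end shiftMap

theorem mem_region_iff {ν : List Step} {k : Fin (numValleys ν)} {x : (augB ν).edges → ℝ} :
    x ∈ region ν k ↔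
      (NetflowCondition ν ((augB ν).extend x)
        (spineFlow ν EdgeKind.bidirectional ((augB ν).extend x)) ∧
        ∀ e ∈ baseEdges ν, 0 ≤ (augB ν).extend x e) ∧
      ∀ l, spineFlow ν EdgeKind.bidirectional ((augB ν).extend x) k ≤
        spineFlow ν EdgeKind.bidirectional ((augB ν).extend x) l :=
  and_congr_left fun _ => mem_flowPolytope_augB

theorem integrallyEquivalent_iInter_region (ν : List Step) (S : Finset (Fin (numValleys ν)))
    (hS : S.Nonempty) : IntegrallyEquivalent (⋂ k ∈ S, region ν k)
      (MixedGraph.inter (fun i => partialAug ν (nuGraphAt ν i)) S hS).flowPolytope := by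
  have hB : IsSpineGraph ν EdgeKind.bidirectional (pathIndices ν) (augB ν) :=
    isSpineGraph_nuGraphB ν
  have hH := isSpineGraph_inter ν S hS
  generalize MixedGraph.inter (fun i => partialAug ν (nuGraphAt ν i)) S hS = H at hH ⊢
  obtain ⟨k, hk⟩ := hS
  let last : Fin (numValleys ν) := ⟨numValleys ν - 1, by have := k.2; omega⟩
  have hlast : ∀ l ∉ pathIndices ν, l = last := by
    intro l hl
    simp only [pathIndices, Finset.mem_filter, Finset.mem_univ, true_and] at hl
    ext
    have := l.2
    simp only [last]
    omega
  have hlast0 : ∀ x : (augB ν).edges → ℝ,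
      spineFlow ν EdgeKind.bidirectional ((augB ν).extend x) last = 0 := fun x =>
    spineFlow_last hB (by simp) x (by simp only [last]; omega)
  have hmem : ∀ x, x ∈ ⋂ k ∈ S, region ν k ↔ ∀ k ∈ S, x ∈ region ν k := fun x => by
    simp only [Set.mem_iInter]
  -- Every index in `S` attains the minimum, so the shift by the value at `k` vanishes on all of
  -- `S`, the edges missing from `H`.
  have hxS : ∀ x ∈ ⋂ k ∈ S, region ν k, ∀ l ∉ Sᶜ,
      spineFlow ν EdgeKind.bidirectional ((augB ν).extend x) l =
        spineFlow ν EdgeKind.bidirectional ((augB ν).extend x) k := by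
    intro x hx l hl
    rw [hmem] at hx
    rw [Finset.mem_compl, not_not] at hl
    exact le_antisymm ((mem_region_iff.1 (hx l hl)).2 k) ((mem_region_iff.1 (hx k hk)).2 l)
  have hy0 : ∀ (y : H.edges → ℝ), ∀ l ∈ S, spineFlow ν EdgeKind.forward (H.extend y) l = 0 :=
    fun y l hl => hH.spineFlow_eq_zero (by simp) y (by simpa using hl)
  have hyl : ∀ (y : H.edges → ℝ), ∀ l ∉ pathIndices ν,
      spineFlow ν EdgeKind.forward (H.extend y) l =
        spineFlow ν EdgeKind.forward (H.extend y) last := fun y l hl => by rw [hlast l hl]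
  refine integrallyEquivalent_of_inverse
    (isLatticePolytope_iInter_region ν ⟨k, hk⟩)
    (shiftMap ν EdgeKind.bidirectional EdgeKind.forward (augB ν) H k).toAffineMap
    (shiftMap ν EdgeKind.forward EdgeKind.bidirectional H (augB ν) last).toAffineMap
    (shiftMap_mapsTo_integerPoints hH (by simp) k)
    (shiftMap_mapsTo_integerPoints hB (by simp) last) ?_ ?_ ?_ ?_
  · intro x hx
    rw [LinearMap.coe_toAffineMap]
    have hflow := spineFlow_shiftMap hH (by simp) k (hxS x hx)
    have hbase := fun e he => extend_shiftMap (κ := EdgeKind.bidirectional) hH k x (e := e) he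
    obtain ⟨⟨h1, h2⟩, h3⟩ := mem_region_iff.1 ((hmem x).1 hx k hk)
    refine (mem_flowPolytope_forward hH).2 ⟨h1.congr hbase _ hflow, fun e he => ?_, fun l => ?_⟩
    · rw [hbase e he]
      exact h2 e he
    · rw [hflow]
      exact sub_nonneg.2 (h3 l)
  · intro y hy
    rw [LinearMap.coe_toAffineMap]
    obtain ⟨h1, h2, h3⟩ := (mem_flowPolytope_forward hH).1 hy
    have hflow := spineFlow_shiftMap hB (by simp) last (hyl y)
    have hbase := fun e he => extend_shiftMap (κ := EdgeKind.forward) hB last y (e := e) he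
    refine (hmem _).2 fun k' hk' => mem_region_iff.2
      ⟨⟨h1.congr hbase _ hflow, fun e he => ?_⟩, fun l => ?_⟩
    · rw [hbase e he]
      exact h2 e he
    -- Before the shift, the flow is zero at `k' ∈ S` and nonnegative elsewhere; a common shift
    -- keeps `k'` minimal.
    · rw [hflow, hflow, hy0 y k' hk']
      exact sub_le_sub_right (h3 l) _
  · intro x hx
    rw [LinearMap.coe_toAffineMap, LinearMap.coe_toAffineMap]
    exact shiftMap_shiftMap hB (by simp) hH (by simp) k last (hxS x hx)
      (fun l hl => by rw [hlast l hl]) (hlast0 x)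
  · intro y _
    rw [LinearMap.coe_toAffineMap, LinearMap.coe_toAffineMap]
    refine shiftMap_shiftMap hH (by simp) hB (by simp) last k (hyl y) (fun l hl => ?_) (hy0 y k hk)
    rw [hy0 y k hk, hy0 y l (by simpa using hl)]

end SimplexSubdivision

theorem theorem1p1 (ν : List SimplexSubdivision.Step) :
    (SimplexSubdivision.partialAug ν (SimplexSubdivision.nuGraphB ν)).flowPolytope =
        (⋃ i : Fin (SimplexSubdivision.numValleys ν), SimplexSubdivision.Q ν i) ∧
    (∀ i : Fin (SimplexSubdivision.numValleys ν),
      SimplexSubdivision.IsLatticePolytope (SimplexSubdivision.Q ν i)) ∧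
    (∀ i j : Fin (SimplexSubdivision.numValleys ν), i ≠ j →
      Disjoint (intrinsicInterior ℝ (SimplexSubdivision.Q ν i))
        (intrinsicInterior ℝ (SimplexSubdivision.Q ν j))) ∧
    (∀ (S : Finset (Fin (SimplexSubdivision.numValleys ν))) (hS : S.Nonempty),
      SimplexSubdivision.IntegrallyEquivalent
        (⋂ i ∈ S, SimplexSubdivision.Q ν i)
        (SimplexSubdivision.MixedGraph.inter
          (fun i => SimplexSubdivision.partialAug ν (SimplexSubdivision.nuGraphAt ν i))
          S hS).flowPolytope) := by
  simp only [SimplexSubdivision.Q_eq_region]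
  refine ⟨SimplexSubdivision.flowPolytope_eq_iUnion_region ν, fun i => ?_, fun i j hij => ?_,
    SimplexSubdivision.integrallyEquivalent_iInter_region ν⟩
  · simpa using SimplexSubdivision.isLatticePolytope_iInter_region ν (Finset.singleton_nonempty i)
  · rw [Set.disjoint_left]
    intro x hi hj
    exact lt_asymm (SimplexSubdivision.lt_of_mem_intrinsicInterior_region hij.symm hi)
      (SimplexSubdivision.lt_of_mem_intrinsicInterior_region hij hj)
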